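/- **Notation.** For a category $\mathcal V$ let $\mathbf M\mathcal V$, $\mathbf S\mathcal V$ and $\mathbf B\mathcal V$ be the categories whose objects are the finite sequences $(X_1,\dots,X_n)$, $n\ge 0$, of objects of $\mathcal V$. There are no morphisms between sequences of different lengths, and a morphism $(X_1,\dots,X_n)\to(Y_1,\dots,Y_n)$ is * in $\mathbf M\mathcal V$: a family of morphisms $f_i:X_i\to Y_i$ of $\mathcal V$; * in $\mathbf S\mathcal V$: a pair $(\rho,(f_i)_i)$ of a permutation $\rho\in\Sigma_n$ and morphisms $f_i:X_i\to Y_{\rho(i)}$; * in $\mathbf B\mathcal V$: a pair $(\beta,(f_i)_i)$ of an element $\beta$ of the $n$-strand braid group and morphisms $f_i:X_i\to Y_{|\beta|(i)}$, where $|\beta|\in\Sigma_n$ is the underlying permutation of $\beta$. These are the values at $\mathcal V$ of the 2-monads $\mathbf M,\mathbf S,\mathbf B$ on $\mathbf{CAT}$ for monoidal, symmetric monoidal and braided monoidal categories. A functor $F:\mathcal V\to\mathcal W$ induces $TF:T\mathcal V\to T\mathcal W$ for $T=\mathbf M,\mathbf S,\mathbf B$, by applying $F$ to all the $X_i$ and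 $f_i$. A monoidal (resp. symmetric monoidal, braided monoidal) category $\mathcal V$ is a pseudo $T$-algebra for $T=\mathbf M$ (resp. $\mathbf S$, $\mathbf B$), with action the functor $\bigotimes:T\mathcal V\to\mathcal V$ given on objects by $(X_1,\dots,X_n)\mapsto X_1\otimes(X_2\otimes(\cdots\otimes(X_n\otimes I)))$. On morphisms it sends $(f_i)_i$ to the tensor product of the $f_i$; it sends $(\rho,(f_i)_i)$ (resp. $(\beta,(f_i)_i)$) to the tensor product $\bigotimes_iX_i\to\bigotimes_iY_{\rho(i)}$ (resp. $\bigotimes_iX_i\to\bigotimes_iY_{|\beta|(i)}$) of the $f_i$ followed by the coherence isomorphism to $\bigotimes_jY_j$ that permutes the factors according to $\rho$ by means of the symmetry (resp. according to $\beta$, the generators of the braid group acting by the braiding of two adjacent factors). A colax monoidal functor $F:\mathcal V\to\mathcal W$ is a functor with a natural family $F(A\otimes B)\to FA\otimes FB$ and a morphism $FI\to I$ satisfying the coassociativity and counit axioms. Between symmetric (resp. braided) monoidal categories it is called symmetric (resp. braided) if the maps $F(A\otimes B)\to FA\otimes FB$ commute with the symmetries (resp. braidings). A colax monoidal (resp.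 symmetric colax monoidal, braided colax monoidal) functor is a colax morphism of pseudo $T$-algebras for $T=\mathbf M$ (resp. $\mathbf S$, $\mathbf B$), with coherence 2-cell $\overline F:F\circ\bigotimes\Rightarrow\bigotimes\circ TF$ whose components $F\bigotimes_iX_i\to\bigotimes_iFX_i$ are the iterated comparison maps. It is called *exact* as a colax morphism of pseudo $T$-algebras if this lax square of functors $$\bigotimes:T\mathcal V\to\mathcal V,\qquad TF:T\mathcal V\to T\mathcal W,\qquad F:\mathcal V\to\mathcal W,\qquad \bigotimes:T\mathcal W\to\mathcal W$$ is exact in the sense of Guitart. That is: for all $X\in\mathcal V$, $Y\in T\mathcal W$ and $\gamma:FX\to\bigotimes Y$, the following category of factorizations of $\gamma$ is connected (in particular non-empty). Its objects are the triples $(g,Z,h)$ with $Z\in T\mathcal V$, $g:X\to\bigotimes Z$ and $h:TF(Z)\to Y$ such that $\bigotimes(h)\circ\overline F_Z\circ Fg=\gamma$. A morphism $(g,Z,h)\to(g',Z',h')$ is a morphism $\delta:Z\to Z'$ of $T\mathcal V$ such that $\bigotimes(\delta)\circ g=g'$ and $h=h'\circ TF(\delta)$. **Proposition.** 1. A symmetric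 colax monoidal functor $F:\mathcal V\to\mathcal W$ between symmetric monoidal categories is exact as a colax morphism of pseudo $\mathbf S$-algebras if and only if it is exact as a colax morphism of pseudo $\mathbf M$-algebras. 2. A braided colax monoidal functor $F:\mathcal V\to\mathcal W$ between braided monoidal categories is exact as a colax morphism of pseudo $\mathbf B$-algebras if and only if it is exact as a colax morphism of pseudo $\mathbf M$-algebras. -/

import Mathlib

open CategoryTheory MonoidalCategory

universe w v u v₁ v₂ u₁ u₂

namespace ExactColax

section TensorList

variable {V : Type u} [Category.{v} V] [MonoidalCategory V] {ι : Type w}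

/-- The iterated tensor product `X a₁ ⊗ (X a₂ ⊗ (⋯ ⊗ (X aₖ ⊗ 𝟙_ V)))` of a family of objects along a
list `[a₁, …, aₖ]` of indices. -/
def tensorList (X : ι → V) : List ι → V
  | [] => 𝟙_ V
  | a :: l => X a ⊗ tensorList X l

/-- Functoriality of `tensorList` in the family: `f a₁ ⊗ (f a₂ ⊗ ⋯)`. -/
def tensorListHom {X Y : ι → V} (f : ∀ i, X i ⟶ Y i) :
    ∀ l : List ι, tensorList X l ⟶ tensorList Y l
  | [] => 𝟙 _
  | a :: l => f a ⊗ₘ tensorListHom f l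

lemma tensorListHom_id (X : ι → V) (l : List ι) :
    tensorListHom (fun i => 𝟙 (X i)) l = 𝟙 _ := by
  induction l with
  | nil => rfl
  | cons a l ih => simp [tensorListHom, ih, tensorList]

lemma tensorListHom_comp {X Y Z : ι → V} (f : ∀ i, X i ⟶ Y i) (g : ∀ i, Y i ⟶ Z i)
    (l : List ι) :
    tensorListHom (fun i => f i ≫ g i) l = tensorListHom f l ≫ tensorListHom g l := by
  induction l with
  | nil => exact (Category.comp_id _).symm
  | cons a l ih =>
    change _ ⊗ₘ tensorListHom _ l = (_ ⊗ₘ _) ≫ (_ ⊗ₘ _)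
    rw [ih, tensorHom_comp_tensorHom]

/-- A family of morphisms `X i ⟶ Y (π i)` lying over the permutation `π`. (It is indexed by pairs
`i, j` with `π i = j` only to avoid transporting along equalities of indices.) -/
abbrev FamilyOver (π : Equiv.Perm ι) (X Y : ι → V) := ∀ i j, π i = j → (X i ⟶ Y j)

/-- The morphism `f a₁ ⊗ (f a₂ ⊗ ⋯)` from the tensor product of `X a₁, X a₂, …` to the tensor product
of `Y (π a₁), Y (π a₂), …`; no symmetry is used here. -/
def tensorListPush {π : Equiv.Perm ι} {X Y : ι → V} (f : FamilyOver π X Y) :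
    ∀ l : List ι, tensorList X l ⟶ tensorList Y (l.map π)
  | [] => 𝟙 _
  | a :: l => f a (π a) rfl ⊗ₘ tensorListPush f l

end TensorList

section Wreath

variable {n : ℕ} {G : Type} [Group G]

/-- The wreath product category of `V` with a group `G` acting on `n` letters through `ρ`: its objects
are the sequences of `n` objects of `V`, and a morphism `(X i) ⟶ (Y i)` consists of `g : G` together
with morphisms `X i ⟶ Y (ρ g i)`. -/
structure Wreath (ρ : G →* Equiv.Perm (Fin n)) (V : Type u) where
  obj : Fin n → V

namespace Wreath

variable {ρ : G →* Equiv.Perm (Fin n)} {V : Type u} [Category.{v} V]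

/-- Morphisms of `Wreath ρ V`: an element `g : G` and morphisms `X i ⟶ Y (ρ g i)`. -/
structure Hom (X Y : Wreath ρ V) where
  elt : G
  map : FamilyOver (ρ elt) X.obj Y.obj

lemma Hom.ext' {X Y : Wreath ρ V} {a b : Hom X Y} (h : a.elt = b.elt)
    (hm : ∀ i j hi hj, a.map i j hi = b.map i j hj) : a = b := by
  obtain ⟨a, f⟩ := a
  obtain ⟨b, g⟩ := b
  obtain rfl : a = b := h
  congr 1
  funext i j hi
  exact hm i j hi hi

instance : Category (Wreath ρ V) where
  Hom X Y := Hom X Y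
  id X := ⟨1, fun i _ h => eqToHom (by rw [← h, map_one]; rfl)⟩
  comp {X Y Z} a b := ⟨b.elt * a.elt, fun i j h =>
    a.map i (ρ a.elt i) rfl ≫ b.map (ρ a.elt i) j (by rw [← h, map_mul]; rfl)⟩
  id_comp {X Y} a := by
    apply Hom.ext' (mul_one _)
    intro i j hi hj
    have key : ∀ k (hk : i = k) (h' : ρ a.elt k = j),
        eqToHom (congrArg X.obj hk) ≫ a.map k j h' = a.map i j hj := by
      rintro k rfl h'
      simp
    exact key _ (by rw [map_one]; rfl) _
  comp_id {X Y} a := by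
    apply Hom.ext' (one_mul _)
    intro i j hi hj
    subst hj
    simp
  assoc a b c := by
    apply Hom.ext' (mul_assoc _ _ _).symm
    intro i j hi hj
    have key : ∀ k (hk : ρ b.elt (ρ a.elt i) = k) (h : ρ c.elt k = j),
        (a.map i _ rfl ≫ b.map _ _ hk) ≫ c.map k j h =
        a.map i _ rfl ≫ b.map _ _ rfl ≫ c.map _ j (by rw [hk, h]) := by
      rintro k rfl h
      simp
    exact key _ (by rw [map_mul]; rfl) _

end Wreath

end Wreath


section Crossing

variable {V : Type u} [Category.{v} V] [MonoidalCategory V]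

/-- Given `c : A ⊗ B ≅ B ⊗ A`, exchange the first two factors of `A ⊗ (B ⊗ L)`. -/
def crossing (c : ∀ A B : V, A ⊗ B ≅ B ⊗ A) (A B L : V) : A ⊗ (B ⊗ L) ≅ B ⊗ (A ⊗ L) :=
  (α_ A B L).symm ≪≫ whiskerRightIso (c A B) L ≪≫ α_ B A L

lemma crossing_natural (c : ∀ A B : V, A ⊗ B ≅ B ⊗ A)
    (hc : ∀ {A A' B B' : V} (f : A ⟶ A') (g : B ⟶ B'),
      (f ⊗ₘ g) ≫ (c A' B').hom = (c A B).hom ≫ (g ⊗ₘ f))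
    {A A' B B' L L' : V} (f : A ⟶ A') (g : B ⟶ B') (h : L ⟶ L') :
    (f ⊗ₘ (g ⊗ₘ h)) ≫ (crossing c A' B' L').hom = (crossing c A B L).hom ≫ (g ⊗ₘ (f ⊗ₘ h)) := by
  simp only [crossing, Iso.trans_hom, Iso.symm_hom, whiskerRightIso_hom, Category.assoc]
  rw [associator_inv_naturality_assoc, ← associator_naturality]
  congr 1
  rw [← tensorHom_id, ← tensorHom_id, tensorHom_comp_tensorHom_assoc,
    tensorHom_comp_tensorHom_assoc, hc]
  simp

lemma crossing_comp_crossing (c d : ∀ A B : V, A ⊗ B ≅ B ⊗ A)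
    (h : ∀ A B, (c A B).hom ≫ (d B A).hom = 𝟙 _) (A B L : V) :
    (crossing c A B L).hom ≫ (crossing d B A L).hom = 𝟙 _ := by
  simp [crossing, ← comp_whiskerRight_assoc, h]

lemma crossing_yang_baxter [BraidedCategory V] (A B C L : V) :
    (crossing (fun A B => β_ A B) A B (C ⊗ L)).hom ≫
      B ◁ (crossing (fun A B => β_ A B) A C L).hom ≫
        (crossing (fun A B => β_ A B) B C (A ⊗ L)).hom =
    A ◁ (crossing (fun A B => β_ A B) B C L).hom ≫
      (crossing (fun A B => β_ A B) A C (B ⊗ L)).hom ≫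
        C ◁ (crossing (fun A B => β_ A B) A B L).hom := by
  have := congrArg (fun t => (α_ A B (C ⊗ L)).inv ≫ (α_ (A ⊗ B) C L).inv ≫
    (α_ A B C).hom ▷ L ≫ t ▷ L ≫ (α_ C (B ⊗ A) L).hom ≫ C ◁ (α_ B A L).hom)
    (BraidedCategory.yang_baxter A B C)
  simp only [comp_whiskerRight, Category.assoc] at this
  simp only [crossing, Iso.trans_hom, Iso.symm_hom, whiskerRightIso_hom]
  convert this using 1
  · monoidal
  · monoidal

end Crossing

section Symmetric

variable {V : Type u} [Category.{v} V] [MonoidalCategory V] [SymmetricCategory V] {ι : Type w}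

/-- The symmetry coherence morphisms between iterated tensor products: those generated under
composition by exchanging two adjacent factors by means of the symmetry, at any position. -/
inductive IsPermutation (X : ι → V) :
    ∀ {l l' : List ι}, (tensorList X l ⟶ tensorList X l') → Prop
  | nil : IsPermutation X (l := []) (l' := []) (𝟙 _)
  | cons (a : ι) {l l' : List ι} {m : tensorList X l ⟶ tensorList X l'} :
      IsPermutation X m → IsPermutation X (l := a :: l) (l' := a :: l') (X a ◁ m)
  | swap (a b : ι) (l : List ι) :
      IsPermutation X (l := a :: b :: l) (l' := b :: a :: l)
        (crossing (fun A B => β_ A B) (X a) (X b) (tensorList X l)).hom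
  | comp {l l' l'' : List ι} {m : tensorList X l ⟶ tensorList X l'}
      {m' : tensorList X l' ⟶ tensorList X l''} :
      IsPermutation X m → IsPermutation X m' → IsPermutation X (m ≫ m')

namespace IsPermutation

lemma id (X : ι → V) (l : List ι) : IsPermutation X (𝟙 (tensorList X l)) := by
  induction l with
  | nil => exact nil
  | cons a l ih =>
    have := ih.cons a
    rwa [whiskerLeft_id] at this

lemma exists_of_perm (X : ι → V) {l l' : List ι} (h : l.Perm l') :
    ∃ m : tensorList X l ⟶ tensorList X l', IsPermutation X m := by
  induction h with
  | nil => exact ⟨_, nil⟩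
  | cons a _ ih => exact ⟨_, ih.choose_spec.cons a⟩
  | swap a b l => exact ⟨_, swap b a l⟩
  | trans _ _ ih ih' => exact ⟨_, ih.choose_spec.comp ih'.choose_spec⟩

/-- `Removal a l r`: the list `r` is obtained from `l` by removing one occurrence of `a`. -/
inductive Removal (a : ι) : List ι → List ι → Type w
  | head (l : List ι) : Removal a (a :: l) l
  | tail (b : ι) {l r : List ι} : Removal a l r → Removal a (b :: l) (b :: r)

lemma Removal.mem {a : ι} {l r : List ι} (R : Removal a l r) : a ∈ l := by
  induction R with
  | head l => simp
  | tail b _ ih => simp [ih]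

lemma Removal.nodup {a : ι} {l r : List ι} (R : Removal a l r) (h : l.Nodup) : r.Nodup := by
  have : r.Sublist l := by
    clear h
    induction R with
    | head l => simp
    | tail b _ ih => simp [ih]
  exact this.nodup h

lemma Removal.unique {a : ι} {l r r' : List ι} (R : Removal a l r) (R' : Removal a l r')
    (h : l.Nodup) : r = r' ∧ HEq R R' := by
  induction R generalizing r' with
  | head l =>
    cases R' with
    | head => exact ⟨rfl, HEq.rfl⟩
    | tail _ R' => exact absurd R'.mem (List.nodup_cons.1 h).1
  | tail b R ih =>
    cases R' with
    | head => exact absurd R.mem (List.nodup_cons.1 h).1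
    | tail _ R' =>
      obtain ⟨rfl, h'⟩ := ih R' (List.nodup_cons.1 h).2
      cases h'
      exact ⟨rfl, HEq.rfl⟩

/-- Move the chosen factor `X a` to the front. -/
def extract (X : ι → V) {a : ι} : ∀ {l r : List ι}, Removal a l r →
    (tensorList X l ≅ X a ⊗ tensorList X r)
  | _, _, .head l => Iso.refl (tensorList X (a :: l))
  | _, _, .tail (r := r) b R => whiskerLeftIso (X b) (extract X R) ≪≫
      crossing (fun A B => β_ A B) (X b) (X a) (tensorList X r)

lemma extract_natural_tail {A B L L' R R' : V} {m : L ⟶ L'} {e : L ≅ A ⊗ R} {e' : L' ≅ A ⊗ R'}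
    {m' : R ⟶ R'} (h : m ≫ e'.hom = e.hom ≫ A ◁ m') :
    B ◁ m ≫ (whiskerLeftIso B e' ≪≫ crossing (fun A B => β_ A B) B A R').hom =
      (whiskerLeftIso B e ≪≫ crossing (fun A B => β_ A B) B A R).hom ≫ A ◁ B ◁ m' := by
  have := crossing_natural (fun A B : V => β_ A B)
    (fun f g => BraidedCategory.braiding_naturality f g) (𝟙 B) (𝟙 A) m'
  simp only [id_tensorHom] at this
  simp only [Iso.trans_hom, whiskerLeftIso_hom, Category.assoc, ← this,
    ← whiskerLeft_comp_assoc, h]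

lemma extract_natural {X : ι → V} {l l' : List ι} {m : tensorList X l ⟶ tensorList X l'}
    (h : IsPermutation X m) {a : ι} {r : List ι} (R : Removal a l r) :
    ∃ (r' : List ι) (R' : Removal a l' r') (m' : tensorList X r ⟶ tensorList X r'),
      IsPermutation X m' ∧ m ≫ (extract X R').hom = (extract X R).hom ≫ X a ◁ m' := by
  induction h generalizing r with
  | nil => cases R
  | cons b hm ih =>
    cases R with
    | head => exact ⟨_, .head _, _, hm, (Category.comp_id _).trans (Category.id_comp _).symm⟩
    | tail _ R =>
      obtain ⟨r', R', m', hm', h'⟩ := ih R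
      exact ⟨_, .tail _ R', _, hm'.cons b, extract_natural_tail h'⟩
  | swap b c l =>
    cases R with
    | head =>
      refine ⟨_, .tail c (.head l), _, IsPermutation.id X _, ?_⟩
      have h : ∀ A B L : V, (crossing (fun A B => β_ A B) A B L).hom ≫
          (whiskerLeftIso B (Iso.refl _) ≪≫ crossing (fun A B => β_ A B) B A L).hom =
          𝟙 _ ≫ A ◁ 𝟙 _ := by
        intro A B L
        simpa using crossing_comp_crossing (fun A B : V => β_ A B) (fun A B => β_ A B)
          (fun A B => SymmetricCategory.symmetry A B) A B L
      exact h _ _ _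
    | tail _ R =>
      cases R with
      | head =>
        refine ⟨_, .head _, _, IsPermutation.id X _, ?_⟩
        have h : ∀ A B L : V, (crossing (fun A B => β_ A B) A B L).hom ≫ 𝟙 _ =
            (whiskerLeftIso A (Iso.refl _) ≪≫ crossing (fun A B => β_ A B) A B L).hom ≫
            B ◁ 𝟙 _ := by
          intro A B L
          simp
        exact h _ _ _
      | tail _ R =>
        refine ⟨_, .tail c (.tail b R), _, swap b c _, ?_⟩
        have h : ∀ {A B C L R : V} (e : L ≅ A ⊗ R), (crossing (fun A B => β_ A B) B C L).hom ≫
            (whiskerLeftIso C (whiskerLeftIso B e ≪≫ crossing (fun A B => β_ A B) B A R) ≪≫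
              crossing (fun A B => β_ A B) C A (B ⊗ R)).hom =
            (whiskerLeftIso B (whiskerLeftIso C e ≪≫ crossing (fun A B => β_ A B) C A R) ≪≫
              crossing (fun A B => β_ A B) B A (C ⊗ R)).hom ≫
            A ◁ (crossing (fun A B => β_ A B) B C R).hom := by
          intro A B C L R e
          have h₁ := crossing_natural (fun A B : V => β_ A B)
            (fun f g => BraidedCategory.braiding_naturality f g) (𝟙 B) (𝟙 C) e.hom
          have h₂ := crossing_yang_baxter B C A R
          simp only [id_tensorHom] at h₁
          simp only [Iso.trans_hom, whiskerLeftIso_hom, Category.assoc, whiskerLeft_comp]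
          rw [← h₂, reassoc_of% h₁]
        exact h _
  | comp _ _ ih ih' =>
    obtain ⟨r', R', m', hm', h'⟩ := ih R
    obtain ⟨r'', R'', m'', hm'', h''⟩ := ih' R'
    refine ⟨_, R'', _, hm'.comp hm'', ?_⟩
    rw [Category.assoc, h'', reassoc_of% h', whiskerLeft_comp]

lemma perm {X : ι → V} {l l' : List ι} {m : tensorList X l ⟶ tensorList X l'}
    (h : IsPermutation X m) : l.Perm l' := by
  induction h with
  | nil => exact .nil
  | cons a _ ih => exact ih.cons a
  | swap a b l => exact .swap b a l
  | comp _ _ ih ih' => exact ih.trans ih'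

lemma eq_id_of_nil {X : ι → V} {l l' : List ι} {m : tensorList X l ⟶ tensorList X l'}
    (h : IsPermutation X m) (hl : l = []) : HEq m (𝟙 (𝟙_ V)) := by
  induction h with
  | nil => exact HEq.rfl
  | cons => cases hl
  | swap => cases hl
  | comp h h' ih ih' =>
    subst hl
    obtain rfl := h.perm.symm.eq_nil
    obtain rfl := h'.perm.symm.eq_nil
    have e := eq_of_heq (ih rfl)
    have e' := eq_of_heq (ih' rfl)
    subst e e'
    exact heq_of_eq (Category.comp_id _)

lemma eq_of_nodup {X : ι → V} {l l' : List ι} {m m' : tensorList X l ⟶ tensorList X l'}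
    (h : IsPermutation X m) (h' : IsPermutation X m') (hl : l'.Nodup) : m = m' := by
  induction l generalizing l' with
  | nil => exact eq_of_heq ((h.eq_id_of_nil rfl).trans (h'.eq_id_of_nil rfl).symm)
  | cons a l ih =>
    obtain ⟨r, R, n, hn, e⟩ := h.extract_natural (.head l)
    obtain ⟨r', R', n', hn', e'⟩ := h'.extract_natural (.head l)
    obtain ⟨rfl, h⟩ := R.unique R' hl
    cases h
    obtain rfl := ih hn hn' (R.nodup hl)
    rw [← cancel_mono (extract X R).hom, e, e']

lemma push {X Y : ι → V} {π : Equiv.Perm ι} (f : FamilyOver π X Y) {l l' : List ι}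
    {m : tensorList X l ⟶ tensorList X l'} (h : IsPermutation X m) :
    ∃ m' : tensorList Y (l.map π) ⟶ tensorList Y (l'.map π), IsPermutation Y m' ∧
      m ≫ tensorListPush f l' = tensorListPush f l ≫ m' := by
  induction h with
  | nil => exact ⟨_, nil, rfl⟩
  | cons a _ ih =>
    obtain ⟨m', hm', e⟩ := ih
    refine ⟨_, hm'.cons (π a), ?_⟩
    have h : ∀ {A A' L L' M M' : V} {m : L ⟶ L'} {m' : M ⟶ M'} {g : A ⟶ A'} {p : L ⟶ M}
        {p' : L' ⟶ M'} (_ : m ≫ p' = p ≫ m'), A ◁ m ≫ (g ⊗ₘ p') = (g ⊗ₘ p) ≫ A' ◁ m' := by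
      intro A A' L L' M M' m m' g p p' h
      rw [← id_tensorHom, ← id_tensorHom, tensorHom_comp_tensorHom, tensorHom_comp_tensorHom, h]
      simp
    exact h e
  | swap a b l =>
    exact ⟨_, swap _ _ _, (crossing_natural (fun A B : V => β_ A B)
      (fun f g => BraidedCategory.braiding_naturality f g) _ _ _).symm⟩
  | comp _ _ ih ih' =>
    obtain ⟨m, hm, e⟩ := ih
    obtain ⟨m', hm', e'⟩ := ih'
    exact ⟨_, hm.comp hm', by rw [Category.assoc, e', reassoc_of% e]⟩

end IsPermutation

/-- The symmetry coherence morphism `X l₁ ⊗ (X l₂ ⊗ ⋯) ⟶ X l'₁ ⊗ (X l'₂ ⊗ ⋯)` for a rearrangement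
`l'` of `l`. If the indices in `l'` are distinct, it is the only morphism satisfying
`IsPermutation`: see `IsPermutation.eq_of_nodup`. -/
noncomputable def permute (X : ι → V) {l l' : List ι} (h : l.Perm l') :
    tensorList X l ⟶ tensorList X l' :=
  (IsPermutation.exists_of_perm X h).choose

lemma permute_spec (X : ι → V) {l l' : List ι} (h : l.Perm l') :
    IsPermutation X (permute X h) :=
  (IsPermutation.exists_of_perm X h).choose_spec

end Symmetric


section Diagram

variable {V : Type u} [Category.{v} V] [MonoidalCategory V] {ι : Type w}

/-- A morphism from `T` to an iterated tensor product of members of the family `X`. -/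
structure Diagram (X : ι → V) (T : V) where
  word : List ι
  hom : T ⟶ tensorList X word

namespace Diagram

variable {X Y Z : ι → V} {S T : V}

/-- Precompose with a morphism. -/
def pre (s : S ⟶ T) (D : Diagram X T) : Diagram X S := ⟨D.1, s ≫ D.2⟩

/-- Tensor on the left with `X a`. -/
def cons (a : ι) (D : Diagram X T) : Diagram X (X a ⊗ T) := ⟨a :: D.1, X a ◁ D.2⟩

/-- Postcompose with `tensorListPush`. -/
def push {π : Equiv.Perm ι} (f : FamilyOver π X Y) (D : Diagram X T) : Diagram Y T :=
  ⟨D.1.map π, D.2 ≫ tensorListPush f D.1⟩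

lemma exists_pre_cons (a : ι) (l : List ι) (u : T ⟶ tensorList X (a :: l)) :
    ∃ s : T ⟶ X a ⊗ tensorList X l,
      (⟨a :: l, u⟩ : Diagram X T) = pre s (cons a (⟨l, 𝟙 _⟩ : Diagram X (tensorList X l))) := by
  refine ⟨u, congrArg (Diagram.mk _) ?_⟩
  have h : ∀ {A L : V} (u : T ⟶ A ⊗ L), u = u ≫ A ◁ 𝟙 L := by simp
  exact h u

lemma push_pre {π : Equiv.Perm ι} (f : FamilyOver π X Y) (s : S ⟶ T) (D : Diagram X T) :
    push f (pre s D) = pre s (push f D) :=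
  congrArg (Diagram.mk _) (Category.assoc _ _ _)

lemma pre_pre {R : V} (r : R ⟶ S) (s : S ⟶ T) (D : Diagram X T) :
    pre r (pre s D) = pre (r ≫ s) D :=
  congrArg (Diagram.mk _) (Category.assoc _ _ _).symm

lemma push_cons {π : Equiv.Perm ι} (f : FamilyOver π X Y) (a : ι) (D : Diagram X T) :
    push f (cons a D) = pre (f a (π a) rfl ▷ T) (cons (π a) (push f D)) := by
  have h : ∀ {A B L M : V} (g : A ⟶ B) (p : T ⟶ L) (q : L ⟶ M),
      A ◁ p ≫ (g ⊗ₘ q) = g ▷ T ≫ B ◁ (p ≫ q) := by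
    intro A B L M g p q
    rw [← id_tensorHom, ← id_tensorHom, ← tensorHom_id, tensorHom_comp_tensorHom,
      tensorHom_comp_tensorHom]
    simp
  exact congrArg (Diagram.mk _) (h _ _ _)

lemma push_push {π γ σ : Equiv.Perm ι} (f : FamilyOver π X Y) (g : FamilyOver γ Y Z)
    (k : FamilyOver σ X Z) (hσ : ∀ i, σ i = γ (π i))
    (hk : ∀ i j hj, k i j hj = f i (π i) rfl ≫ g (π i) j ((hσ i).symm.trans hj))
    (D : Diagram X T) :
    push g (push f D) = push k D := by
  obtain ⟨l, u⟩ := D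
  induction l generalizing T with
  | nil => exact congrArg (Diagram.mk _) (congrArg (· ≫ 𝟙 _) (Category.comp_id _))
  | cons a l ih =>
    obtain ⟨s, hs⟩ := exists_pre_cons a l u
    rw [hs]
    simp only [push_pre, push_cons, ih]
    congr 1
    rw [pre_pre, ← comp_whiskerRight, ← hk a _ (hσ a)]
    generalize push k _ = E
    have : ∀ b (hb : σ a = b), pre (k a b hb ▷ _) (cons b E) =
        pre (k a (σ a) rfl ▷ _) (cons (σ a) E) := by
      rintro b rfl
      rfl
    exact this _ _

lemma push_id {σ : Equiv.Perm ι} (k : FamilyOver σ X X) (hσ : ∀ i, σ i = i)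
    (hk : ∀ i, k i i (hσ i) = 𝟙 _) (D : Diagram X T) : push k D = D := by
  obtain ⟨l, u⟩ := D
  induction l generalizing T with
  | nil => exact congrArg (Diagram.mk _) (Category.comp_id _)
  | cons a l ih =>
    obtain ⟨s, hs⟩ := exists_pre_cons a l u
    rw [hs]
    simp only [push_pre, push_cons, ih]
    congr 1
    generalize (⟨l, 𝟙 _⟩ : Diagram X _) = E
    have : ∀ b (hb : σ a = b) (hab : b = a), pre (k a b hb ▷ _) (cons b E) = cons a E := by
      rintro b hb rfl
      rw [hk]
      have h : ∀ {A L M : V} (q : L ⟶ M), 𝟙 A ▷ L ≫ A ◁ q = A ◁ q := by simp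
      exact congrArg (Diagram.mk _) (h _)
    exact this _ _ (hσ a)

lemma comp_permute_congr [SymmetricCategory V] {D D' : Diagram X T} (h : D = D') {l : List ι}
    (p : D.1.Perm l) (p' : D'.1.Perm l) : D.2 ≫ permute X p = D'.2 ≫ permute X p' := by
  subst h
  rfl

/-- Exchange the entries in positions `i` and `i + 1` (if there are such entries). -/
def swapAt : ℕ → List ι → List ι
  | 0, [] => []
  | 0, [a] => [a]
  | 0, a :: b :: l => b :: a :: l
  | _ + 1, [] => []
  | i + 1, a :: l => a :: swapAt i l

lemma length_swapAt : ∀ (i : ℕ) (l : List ι), (swapAt i l).length = l.length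
  | 0, [] => rfl
  | 0, [_] => rfl
  | 0, _ :: _ :: _ => rfl
  | _ + 1, [] => rfl
  | i + 1, _ :: l => congrArg (· + 1) (length_swapAt i l)

/-- The morphism that exchanges the factors in positions `i` and `i + 1` by means of `c`. -/
def crossingAt (c : ∀ A B : V, A ⊗ B ≅ B ⊗ A) (X : ι → V) :
    ∀ (i : ℕ) (l : List ι), tensorList X l ⟶ tensorList X (swapAt i l)
  | 0, [] => 𝟙 _
  | 0, [_] => 𝟙 _
  | 0, a :: b :: l => (crossing c (X a) (X b) (tensorList X l)).hom
  | _ + 1, [] => 𝟙 _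
  | i + 1, a :: l => X a ◁ crossingAt c X i l

/-- Postcompose with `crossingAt c X i`. -/
def step (c : ∀ A B : V, A ⊗ B ≅ B ⊗ A) (i : ℕ) (D : Diagram X T) : Diagram X T :=
  ⟨swapAt i D.1, D.2 ≫ crossingAt c X i D.1⟩

variable (c d : ∀ A B : V, A ⊗ B ≅ B ⊗ A)

lemma step_pre (i : ℕ) (s : S ⟶ T) (D : Diagram X T) :
    step c i (pre s D) = pre s (step c i D) :=
  congrArg (Diagram.mk _) (Category.assoc _ _ _)

lemma step_cons (i : ℕ) (a : ι) (D : Diagram X T) :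
    step c (i + 1) (cons a D) = cons a (step c i D) :=
  congrArg (Diagram.mk _) (whiskerLeft_comp _ _ _).symm

lemma step_step (h : ∀ A B, (c A B).hom ≫ (d B A).hom = 𝟙 _) (i : ℕ) (D : Diagram X T) :
    step d i (step c i D) = D := by
  obtain ⟨l, u⟩ := D
  have triv : ∀ {T L : V} (u : T ⟶ L), (u ≫ 𝟙 _) ≫ 𝟙 _ = u := by simp
  induction i generalizing T l with
  | zero =>
    match l, u with
    | [], u => exact congrArg (Diagram.mk _) (triv _)
    | [a], u => exact congrArg (Diagram.mk _) (triv _)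
    | a :: b :: l, u =>
      have : ∀ {A B L : V} (u : T ⟶ A ⊗ B ⊗ L),
          (u ≫ (crossing c A B L).hom) ≫ (crossing d B A L).hom = u := by
        intro A B L u
        rw [Category.assoc, crossing_comp_crossing c d h, Category.comp_id]
      exact congrArg (Diagram.mk _) (this _)
  | succ i ih =>
    match l, u with
    | [], u => exact congrArg (Diagram.mk _) (triv _)
    | a :: l, u =>
      obtain ⟨s, hs⟩ := exists_pre_cons a l u
      rw [hs]
      simp only [step_pre, step_cons]
      rw [ih]

lemma step_push {π : Equiv.Perm ι} (f : FamilyOver π X Y)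
    (hc : ∀ {A A' B B' : V} (f : A ⟶ A') (g : B ⟶ B'),
      (f ⊗ₘ g) ≫ (c A' B').hom = (c A B).hom ≫ (g ⊗ₘ f)) (i : ℕ) (D : Diagram X T) :
    step c i (push f D) = push f (step c i D) := by
  obtain ⟨l, u⟩ := D
  induction i generalizing T l with
  | zero =>
    match l, u with
    | [], u => rfl
    | [a], u =>
      have : ∀ {L M : V} (u : T ⟶ L) (f : L ⟶ M), (u ≫ f) ≫ 𝟙 _ = (u ≫ 𝟙 _) ≫ f := by simp
      exact congrArg (Diagram.mk _) (this u _)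
    | a :: b :: l, u =>
      have h : ∀ {A A' B B' L L' : V} (u : T ⟶ A ⊗ (B ⊗ L)) (f : A ⟶ A') (g : B ⟶ B')
          (h : L ⟶ L'), (u ≫ (f ⊗ₘ (g ⊗ₘ h))) ≫ (crossing c A' B' L').hom =
          (u ≫ (crossing c A B L).hom) ≫ (g ⊗ₘ (f ⊗ₘ h)) := by
        intros
        simp [crossing_natural c hc _ _ _]
      exact congrArg (Diagram.mk _) (h u _ _ _)
  | succ i ih =>
    match l, u with
    | [], u => rfl
    | a :: l, u =>
      obtain ⟨s, hs⟩ := exists_pre_cons a l u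
      rw [hs]
      simp only [step_pre, push_pre, step_cons, push_cons, ih]

lemma step_far (hc : ∀ {A A' B B' : V} (f : A ⟶ A') (g : B ⟶ B'),
      (f ⊗ₘ g) ≫ (c A' B').hom = (c A B).hom ≫ (g ⊗ₘ f)) (i j : ℕ) (hij : i + 2 ≤ j)
    (D : Diagram X T) : step c i (step c j D) = step c j (step c i D) := by
  obtain ⟨l, u⟩ := D
  induction i generalizing T l j with
  | zero =>
    obtain ⟨j, rfl⟩ : ∃ k, j = k + 2 := ⟨j - 2, by omega⟩
    match l, u with
    | [], u => rfl
    | [a], u =>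
      have : ∀ {L M : V} (u : T ⟶ L) (f : L ⟶ M), (u ≫ f) ≫ 𝟙 _ = (u ≫ 𝟙 _) ≫ f := by simp
      exact congrArg (Diagram.mk _) (this u _)
    | a :: b :: l, u =>
      have h : ∀ {A B L L' : V} (u : T ⟶ A ⊗ (B ⊗ L)) (h : L ⟶ L'),
          (u ≫ (A ◁ B ◁ h)) ≫ (crossing c A B L').hom =
          (u ≫ (crossing c A B L).hom) ≫ (B ◁ A ◁ h) := by
        intro A B L L' u h
        have := crossing_natural c hc (𝟙 A) (𝟙 B) h
        simp only [id_tensorHom] at this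
        simp [this]
      exact congrArg (Diagram.mk _) (h u _)
  | succ i ih =>
    obtain ⟨j, rfl⟩ : ∃ k, j = k + 1 := ⟨j - 1, by omega⟩
    match l, u with
    | [], u => rfl
    | a :: l, u =>
      obtain ⟨s, hs⟩ := exists_pre_cons a l u
      rw [hs]
      simp only [step_pre, step_cons, ih j (by omega)]

lemma step_yang_baxter [BraidedCategory V] (i : ℕ) (D : Diagram X T) (h : i + 2 < D.1.length) :
    step (fun A B => β_ A B) i (step (fun A B => β_ A B) (i + 1)
      (step (fun A B => β_ A B) i D)) =
    step (fun A B => β_ A B) (i + 1) (step (fun A B => β_ A B) i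
      (step (fun A B => β_ A B) (i + 1) D)) := by
  obtain ⟨l, u⟩ := D
  induction i generalizing T l with
  | zero =>
    match l, u, h with
    | a :: b :: e :: l, u, h =>
      have h : ∀ {A B C L : V} (u : T ⟶ A ⊗ (B ⊗ (C ⊗ L))),
          ((u ≫ (crossing (fun A B => β_ A B) A B (C ⊗ L)).hom) ≫
          B ◁ (crossing (fun A B => β_ A B) A C L).hom) ≫
            (crossing (fun A B => β_ A B) B C (A ⊗ L)).hom =
          ((u ≫ A ◁ (crossing (fun A B => β_ A B) B C L).hom) ≫
            (crossing (fun A B => β_ A B) A C (B ⊗ L)).hom) ≫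
              C ◁ (crossing (fun A B => β_ A B) A B L).hom := by
        intro A B C L u
        simp only [Category.assoc, crossing_yang_baxter A B C L]
      exact congrArg (Diagram.mk _) (h u)
  | succ i ih =>
    match l, u, h with
    | a :: l, u, h =>
      have ih' := ih l (𝟙 _) (Nat.lt_of_succ_lt_succ h)
      obtain ⟨s, hs⟩ := exists_pre_cons a l u
      rw [hs]
      simp only [step_pre, step_cons, ih']

end Diagram

end Diagram

section Braid

/-- The Artin relations on `σ₀, …, σₙ₋₂`: `σᵢ σⱼ σᵢ = σⱼ σᵢ σⱼ` for `j = i + 1`, and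
`σᵢ σⱼ = σⱼ σᵢ` for `j ≥ i + 2`. -/
def braidRels (n : ℕ) : Set (FreeGroup (Fin (n - 1))) :=
  {r | (∃ i j : Fin (n - 1), i.val + 1 = j.val ∧
      r = .of i * .of j * .of i * (.of j * .of i * .of j)⁻¹) ∨
    (∃ i j : Fin (n - 1), i.val + 2 ≤ j.val ∧ r = .of i * .of j * (.of j * .of i)⁻¹)}

/-- The braid group on `n` strands (Artin's presentation). -/
abbrev BraidGroup (n : ℕ) := PresentedGroup (braidRels n)

lemma braid_toGroup_aux {n : ℕ} {G : Type*} [Group G] (s : Fin (n - 1) → G)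
    (h₁ : ∀ i j : Fin (n - 1), i.val + 1 = j.val → s i * s j * s i = s j * s i * s j)
    (h₂ : ∀ i j : Fin (n - 1), i.val + 2 ≤ j.val → s i * s j = s j * s i) :
    ∀ r ∈ braidRels n, FreeGroup.lift s r = 1 := by
  rintro r (⟨i, j, h, rfl⟩ | ⟨i, j, h, rfl⟩)
  · simp only [map_mul, map_inv, FreeGroup.lift_apply_of]
    rw [h₁ i j h, mul_inv_cancel]
  · simp only [map_mul, map_inv, FreeGroup.lift_apply_of]
    rw [h₂ i j h, mul_inv_cancel]

/-- The transposition of `i` and `i + 1`. -/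
def adjacentSwap (n : ℕ) (i : Fin (n - 1)) : Equiv.Perm (Fin n) :=
  Equiv.swap ⟨i.val, by omega⟩ ⟨i.val + 1, by omega⟩

/-- The underlying permutation of a braid. -/
def braidPerm (n : ℕ) : BraidGroup n →* Equiv.Perm (Fin n) :=
  PresentedGroup.toGroup (f := adjacentSwap n) <| braid_toGroup_aux _
    (by
      rintro ⟨i, hi⟩ ⟨j, hj⟩ h
      obtain rfl : i + 1 = j := h
      have h₁ : (⟨i, by omega⟩ : Fin n) ≠ ⟨i + 1, by omega⟩ := by simp
      have h₂ : (⟨i, by omega⟩ : Fin n) ≠ ⟨i + 1 + 1, by omega⟩ := by simp; omega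
      have h₃ : (⟨i + 1, by omega⟩ : Fin n) ≠ ⟨i + 1 + 1, by omega⟩ := by simp
      simp only [adjacentSwap]
      have key : ∀ x y z : Fin n, x ≠ y → x ≠ z → y ≠ z → Equiv.swap x y * Equiv.swap y z *
          Equiv.swap x y = Equiv.swap y z * Equiv.swap x y * Equiv.swap y z := by
        intro x y z h₁ h₂ h₃
        rw [Equiv.swap_mul_swap_mul_swap h₁ h₂, Equiv.swap_comm z x,
          ← Equiv.swap_mul_swap_mul_swap h₃.symm h₂.symm, Equiv.swap_comm y x,
          Equiv.swap_comm z y]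
      exact key _ _ _ h₁ h₂ h₃)
    (by
      rintro ⟨i, hi⟩ ⟨j, hj⟩ h
      have h : i + 2 ≤ j := h
      simp only [adjacentSwap]
      apply Equiv.Perm.Disjoint.commute
      rw [Equiv.Perm.disjoint_iff_disjoint_support, Equiv.Perm.support_swap (by simp),
        Equiv.Perm.support_swap (by simp)]
      simp
      omega)

lemma braidPerm_of {n : ℕ} (i : Fin (n - 1)) :
    braidPerm n (.of i) = adjacentSwap n i := PresentedGroup.toGroup.of _

lemma braid_induction {n : ℕ} {P : BraidGroup n → Prop} (one : P 1)
    (of : ∀ i, P (.of i)) (inv_of : ∀ i, P (.of i)⁻¹) (mul : ∀ a b, P a → P b → P (a * b))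
    (b : BraidGroup n) : P b := by
  induction b using PresentedGroup.induction_on with
  | H z =>
    induction z using FreeGroup.induction_on with
    | C1 => exact one
    | of i => exact of i
    | inv_of i _ => exact inv_of i
    | mul a b ha hb => exact mul _ _ ha hb

variable {V : Type u} [Category.{v} V] [MonoidalCategory V] [BraidedCategory V]

/-- The braiding `A ⊗ B ≅ B ⊗ A`. -/
abbrev posBraiding (V : Type u) [Category.{v} V] [MonoidalCategory V] [BraidedCategory V]
    (A B : V) : A ⊗ B ≅ B ⊗ A := β_ A B

/-- The inverse braiding `A ⊗ B ≅ B ⊗ A`, that is, the inverse of `β_ B A`. -/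
abbrev negBraiding (V : Type u) [Category.{v} V] [MonoidalCategory V] [BraidedCategory V]
    (A B : V) : A ⊗ B ≅ B ⊗ A := (β_ B A).symm

lemma posBraiding_natural {A A' B B' : V} (f : A ⟶ A') (g : B ⟶ B') :
    (f ⊗ₘ g) ≫ (posBraiding V A' B').hom = (posBraiding V A B).hom ≫ (g ⊗ₘ f) :=
  BraidedCategory.braiding_naturality f g

lemma negBraiding_natural {A A' B B' : V} (f : A ⟶ A') (g : B ⟶ B') :
    (f ⊗ₘ g) ≫ (negBraiding V A' B').hom = (negBraiding V A B).hom ≫ (g ⊗ₘ f) := by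
  simp

variable {ι : Type w} (n : ℕ)

/-- Postcomposition with the braiding of the factors in positions `i` and `i + 1`, as a permutation of
the morphisms from `T` to the `n`-fold tensor products of members of `X`. -/
def crossingPerm (X : ι → V) (T : V) (i : ℕ) :
    Equiv.Perm {D : Diagram X T // D.word.length = n} where
  toFun D := ⟨D.1.step (posBraiding V) i, (Diagram.length_swapAt i _).trans D.2⟩
  invFun D := ⟨D.1.step (negBraiding V) i, (Diagram.length_swapAt i _).trans D.2⟩
  left_inv D := Subtype.ext (Diagram.step_step _ _ (by simp) i D.1)
  right_inv D := Subtype.ext (Diagram.step_step _ _ (by simp) i D.1)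

/-- The action of the braid group on the morphisms from `T` to the `n`-fold tensor products of members
of `X`: the generator `σᵢ` acts by postcomposition with the braiding of the factors in positions `i`
and `i + 1`. -/
def braidAction (X : ι → V) (T : V) :
    BraidGroup n →* Equiv.Perm {D : Diagram X T // D.word.length = n} :=
  PresentedGroup.toGroup (f := fun i => crossingPerm n X T i.val) <| braid_toGroup_aux _
    (by
      rintro ⟨i, hi⟩ ⟨j, hj⟩ h
      obtain rfl : i + 1 = j := h
      ext1 D
      exact Subtype.ext (Diagram.step_yang_baxter i D.1 (by rw [D.2]; omega)))
    (by
      rintro ⟨i, hi⟩ ⟨j, hj⟩ h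
      ext1 D
      exact Subtype.ext (Diagram.step_far _ posBraiding_natural i j h D.1))

variable {n}

lemma braidAction_of (X : ι → V) (T : V) (i : Fin (n - 1)) :
    braidAction n X T (.of i) = crossingPerm n X T i.val := PresentedGroup.toGroup.of _

lemma braidAction_pre {X : ι → V} {S T : V} (s : S ⟶ T) (b : BraidGroup n) :
    ∀ D : {D : Diagram X T // D.word.length = n},
      braidAction n X S b ⟨D.1.pre s, D.2⟩ =
        ⟨(braidAction n X T b D).1.pre s, (braidAction n X T b D).2⟩ := by
  induction b using braid_induction with
  | one => intro D; simp
  | of i =>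
    intro D
    rw [braidAction_of, braidAction_of]
    exact Subtype.ext (Diagram.step_pre _ _ _ _)
  | inv_of i =>
    intro D
    rw [map_inv, map_inv, braidAction_of, braidAction_of]
    exact Subtype.ext (Diagram.step_pre _ _ _ _)
  | mul a b ha hb =>
    intro D
    rw [map_mul, map_mul, Equiv.Perm.mul_apply, Equiv.Perm.mul_apply, hb, ha]

lemma braidAction_push {X Y : ι → V} {T : V} {π : Equiv.Perm ι} (f : FamilyOver π X Y)
    (b : BraidGroup n) :
    ∀ D : {D : Diagram X T // D.word.length = n},
      braidAction n Y T b ⟨D.1.push f, (List.length_map _).trans D.2⟩ =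
        ⟨(braidAction n X T b D).1.push f,
          (List.length_map _).trans (braidAction n X T b D).2⟩ := by
  induction b using braid_induction with
  | one => intro D; simp
  | of i =>
    intro D
    rw [braidAction_of, braidAction_of]
    exact Subtype.ext (Diagram.step_push _ _ posBraiding_natural _ _)
  | inv_of i =>
    intro D
    rw [map_inv, map_inv, braidAction_of, braidAction_of]
    exact Subtype.ext (Diagram.step_push _ _ negBraiding_natural _ _)
  | mul a b ha hb =>
    intro D
    rw [map_mul, map_mul, Equiv.Perm.mul_apply, Equiv.Perm.mul_apply, hb, ha]

lemma getElem?_swapAt (i : ℕ) (l : List ι) (h : i + 1 < l.length) (k : ℕ) :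
    (Diagram.swapAt i l)[k]? = l[if k = i then i + 1 else if k = i + 1 then i else k]? := by
  induction i generalizing l k with
  | zero =>
    match l, h with
    | a :: b :: l, h =>
      match k with
      | 0 => rfl
      | 1 => rfl
      | k + 2 => rfl
  | succ i ih =>
    match l, h with
    | a :: l, h =>
      match k with
      | 0 => simp [Diagram.swapAt]
      | k + 1 =>
        have := ih l (Nat.lt_of_succ_lt_succ h) k
        simp only [Diagram.swapAt, List.getElem?_cons_succ, this, Nat.add_right_cancel_iff]
        split_ifs <;> simp

lemma swapAt_ofFn (i : Fin (n - 1)) (p : Fin n → ι) :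
    Diagram.swapAt i.val (List.ofFn p) = List.ofFn (p ∘ adjacentSwap n i) := by
  apply List.ext_getElem?
  intro k
  rw [getElem?_swapAt _ _ (by simp; omega)]
  simp only [List.getElem?_ofFn, Function.comp, adjacentSwap]
  by_cases hk : k < n
  · rw [dif_pos hk]
    split_ifs <;> first | omega | skip
    all_goals congr 2
    all_goals simp_all [Equiv.swap_apply_def]
  · have h₁ := i.2
    rw [if_neg (by omega), if_neg (by omega), dif_neg hk, dif_neg hk]

lemma braidAction_word {X : ι → V} {T : V} (b : BraidGroup n) :
    ∀ (D : {D : Diagram X T // D.word.length = n}) (p : Fin n → ι), D.1.word = List.ofFn p →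
      (braidAction n X T b D).1.word = List.ofFn (p ∘ ⇑(braidPerm n b)⁻¹) := by
  induction b using braid_induction with
  | one => intro D p h; simpa using h
  | of i =>
    intro D p h
    rw [braidAction_of, braidPerm_of]
    change Diagram.swapAt i.val D.1.word = _
    rw [h, swapAt_ofFn]
    simp [adjacentSwap]
  | inv_of i =>
    intro D p h
    rw [map_inv, map_inv, braidAction_of, braidPerm_of]
    change Diagram.swapAt i.val D.1.word = _
    rw [h, swapAt_ofFn]
    simp
  | mul a b ha hb =>
    intro D p h
    rw [map_mul, map_mul, Equiv.Perm.mul_apply, ha _ _ (hb _ _ h)]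
    simp [Function.comp_assoc]

end Braid

section Free

/-- The value at `V` of the 2-monad for monoidal categories: objects are finite sequences of
objects of `V`, and morphisms are the sequences of morphisms of `V` (of equal length). -/
abbrev FreeMonoidal (V : Type u) := Σ n : ℕ, (Fin n → V)

/-- The value at `V` of the 2-monad for symmetric monoidal categories: objects are finite sequences
of objects of `V`, and a morphism `(X₁, …, Xₙ) ⟶ (Y₁, …, Yₙ)` is a permutation `ρ` of `n` letters with
morphisms `Xᵢ ⟶ Y_{ρ i}`. -/
abbrev FreeSymmetric (V : Type u) := Σ n : ℕ, Wreath (MonoidHom.id (Equiv.Perm (Fin n))) V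

/-- The value at `V` of the 2-monad for braided monoidal categories: objects are finite sequences
of objects of `V`, and a morphism `(X₁, …, Xₙ) ⟶ (Y₁, …, Yₙ)` is a braid `b` on `n` strands with
morphisms `Xᵢ ⟶ Y_{ρ i}`, where `ρ` is the underlying permutation of `b`. -/
abbrev FreeBraided (V : Type u) := Σ n : ℕ, Wreath (braidPerm n) V

variable {V : Type u₁} [Category.{v₁} V] {W : Type u₂} [Category.{v₂} W]

/-- Apply a functor to each entry of a sequence of objects. -/
@[simps]
def piMap (n : ℕ) (F : V ⥤ W) : (Fin n → V) ⥤ (Fin n → W) where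
  obj X := fun i => F.obj (X i)
  map f := fun i => F.map (f i)

/-- Apply a functor to each entry of a sequence of objects. -/
@[simps]
def Wreath.mapFunctor {n : ℕ} {G : Type} [Group G] (ρ : G →* Equiv.Perm (Fin n)) (F : V ⥤ W) :
    Wreath ρ V ⥤ Wreath ρ W where
  obj X := ⟨fun i => F.obj (X.obj i)⟩
  map f := ⟨f.elt, fun i j h => F.map (f.map i j h)⟩
  map_id X := by
    refine Wreath.Hom.ext' ?_ ?_
    · rfl
    intro i j h _
    have e : i = j := by
      rw [← h]
      change i = ρ 1 i
      simp
    exact eqToHom_map F (congrArg X.obj e)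
  map_comp f g := by
    refine Wreath.Hom.ext' ?_ ?_
    · rfl
    intro i j _ _
    exact F.map_comp _ _

/-- The 2-monad for monoidal categories, on functors. -/
def FreeMonoidal.map (F : V ⥤ W) : FreeMonoidal V ⥤ FreeMonoidal W :=
  Sigma.desc fun n => piMap n F ⋙ Sigma.incl (C := fun n : ℕ => Fin n → W) n

/-- The 2-monad for symmetric monoidal categories, on functors. -/
def FreeSymmetric.map (F : V ⥤ W) : FreeSymmetric V ⥤ FreeSymmetric W :=
  Sigma.desc fun n => Wreath.mapFunctor (MonoidHom.id (Equiv.Perm (Fin n))) F ⋙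
    Sigma.incl (C := fun n : ℕ => Wreath (MonoidHom.id (Equiv.Perm (Fin n))) W) n

/-- The 2-monad for braided monoidal categories, on functors. -/
def FreeBraided.map (F : V ⥤ W) : FreeBraided V ⥤ FreeBraided W :=
  Sigma.desc fun n => Wreath.mapFunctor (braidPerm n) F ⋙
    Sigma.incl (C := fun n : ℕ => Wreath (braidPerm n) W) n

end Free

section Tensor

variable {V : Type u} [Category.{v} V] [MonoidalCategory V] {n : ℕ}

/-- The `n`-fold tensor product `X₁ ⊗ (X₂ ⊗ (⋯ ⊗ (Xₙ ⊗ 𝟙_ V)))` as a functor of `n` variables. -/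
def tensorPi (V : Type u) [Category.{v} V] [MonoidalCategory V] (n : ℕ) : (Fin n → V) ⥤ V where
  obj X := tensorList X (List.finRange n)
  map f := tensorListHom f (List.finRange n)
  map_id X := tensorListHom_id X _
  map_comp f g := tensorListHom_comp f g _

/-- The `n`-fold tensor product in a symmetric monoidal category: a permutation `ρ` with morphisms
`fᵢ : Xᵢ ⟶ Y_{ρ i}` is sent to the composite
`⨂ᵢ Xᵢ ⟶ ⨂ᵢ Y_{ρ i} ⟶ ⨂ⱼ Yⱼ` of the tensor product of the `fᵢ` and the symmetry coherence. -/
noncomputable def tensorSymmetric (V : Type u) [Category.{v} V] [MonoidalCategory V]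
    [SymmetricCategory V] (n : ℕ) : Wreath (MonoidHom.id (Equiv.Perm (Fin n))) V ⥤ V where
  obj X := tensorList X.obj (List.finRange n)
  map {X Y} f := tensorListPush f.map (List.finRange n) ≫
    permute Y.obj (Equiv.Perm.map_finRange_perm f.elt)
  map_id X := by
    have h := Diagram.push_id (Wreath.Hom.map (𝟙 X)) (fun _ => rfl) (fun _ => rfl)
      ⟨List.finRange n, 𝟙 _⟩
    have := Diagram.comp_permute_congr h (Equiv.Perm.map_finRange_perm _) (List.Perm.refl _)
    simp only [Diagram.push, Category.id_comp] at this
    refine this.trans ?_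
    exact (permute_spec _ _).eq_of_nodup (IsPermutation.id _ _) (List.nodup_finRange n)
  map_comp {X Y Z} f g := by
    have h := Diagram.push_push f.map g.map (Wreath.Hom.map (f ≫ g)) (fun _ => rfl)
      (fun _ _ _ => rfl) ⟨List.finRange n, 𝟙 _⟩
    have p := Equiv.Perm.map_finRange_perm f.elt
    have q := Equiv.Perm.map_finRange_perm g.elt
    have := Diagram.comp_permute_congr h ((p.map g.elt).trans q)
      (Equiv.Perm.map_finRange_perm _)
    simp only [Diagram.push, Category.id_comp] at this
    refine this.symm.trans ?_
    obtain ⟨m, hm, e⟩ := (permute_spec Y.obj p).push g.map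
    simp only [Category.assoc]
    rw [reassoc_of% e]
    congr 2
    exact (permute_spec _ _).eq_of_nodup (hm.comp (permute_spec _ _)) (List.nodup_finRange n)

lemma Diagram.eq_mk {ι : Type w} {X : ι → V} {T : V} (D : Diagram X T) {l : List ι}
    (h : D.word = l) : D = ⟨l, D.hom ≫ eqToHom (congrArg (tensorList X) h)⟩ := by
  subst h
  exact congrArg (Diagram.mk _) (Category.comp_id _).symm

section Braided

variable [BraidedCategory V]

/-- The tensor product `⨂ᵢ Xᵢ ⟶ ⨂ᵢ Y_{ρ i}` of the components of a morphism of `Wreath`. -/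
def Wreath.Hom.diagram {X Y : Wreath (braidPerm n) V} (f : Wreath.Hom X Y) :
    {D : Diagram Y.obj (tensorList X.obj (List.finRange n)) // D.word.length = n} :=
  ⟨⟨(List.finRange n).map (braidPerm n f.elt), tensorListPush f.map (List.finRange n)⟩, by simp⟩

lemma word_braidAction_diagram {X Y : Wreath (braidPerm n) V} (f : Wreath.Hom X Y) :
    (braidAction n _ _ f.elt f.diagram).1.word = List.finRange n := by
  rw [braidAction_word f.elt f.diagram (braidPerm n f.elt)
    (by rw [List.ofFn_eq_map]; rfl), List.finRange]
  congr 1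
  funext i
  simp

/-- The composite `⨂ᵢ Xᵢ ⟶ ⨂ᵢ Y_{ρ i} ⟶ ⨂ⱼ Yⱼ` of the tensor product of the components `fᵢ` with the
braiding morphism of the braid. (The last map is an identity: the braid takes the sequence
`Y_{ρ 1}, …, Y_{ρ n}` to `Y₁, …, Yₙ`.) -/
def braidedTensorMap {X Y : Wreath (braidPerm n) V} (f : Wreath.Hom X Y) :
    tensorList X.obj (List.finRange n) ⟶ tensorList Y.obj (List.finRange n) :=
  (braidAction n _ _ f.elt f.diagram).1.hom ≫
    eqToHom (congrArg (tensorList Y.obj) (word_braidAction_diagram f))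

lemma braidAction_diagram {X Y : Wreath (braidPerm n) V} (f : Wreath.Hom X Y) :
    braidAction n _ _ f.elt f.diagram =
      ⟨⟨List.finRange n, braidedTensorMap f⟩, List.length_finRange⟩ :=
  Subtype.ext (Diagram.eq_mk _ (word_braidAction_diagram f))

lemma braidedTensorMap_eq {X Y : Wreath (braidPerm n) V} (f : Wreath.Hom X Y)
    {m : tensorList X.obj (List.finRange n) ⟶ tensorList Y.obj (List.finRange n)}
    (h : braidAction n _ _ f.elt f.diagram = ⟨⟨List.finRange n, m⟩, List.length_finRange⟩) :
    braidedTensorMap f = m := by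
  rw [braidAction_diagram] at h
  simpa using h

/-- The `n`-fold tensor product in a braided monoidal category: a braid with underlying permutation `ρ`
and morphisms `fᵢ : Xᵢ ⟶ Y_{ρ i}` is sent to `⨂ᵢ Xᵢ ⟶ ⨂ᵢ Y_{ρ i} ⟶ ⨂ⱼ Yⱼ`. -/
def tensorBraided (V : Type u) [Category.{v} V] [MonoidalCategory V] [BraidedCategory V] (n : ℕ) :
    Wreath (braidPerm n) V ⥤ V where
  obj X := tensorList X.obj (List.finRange n)
  map f := braidedTensorMap f
  map_id X := by
    apply braidedTensorMap_eq
    have h := Diagram.push_id (Wreath.Hom.map (𝟙 X)) (fun i => by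
      change braidPerm n 1 i = i
      simp) (fun _ => rfl) ⟨List.finRange n, 𝟙 _⟩
    have e : Wreath.Hom.elt (𝟙 X) = 1 := rfl
    rw [e, map_one]
    apply Subtype.ext
    refine Eq.trans ?_ h
    exact congrArg (Diagram.mk _) (Category.id_comp _).symm
  map_comp {X Y Z} f g := by
    apply braidedTensorMap_eq
    have e : Wreath.Hom.elt (f ≫ g) = g.elt * f.elt := rfl
    have h := Diagram.push_push f.map g.map (Wreath.Hom.map (f ≫ g)) (fun i => by
      rw [e, map_mul]; rfl) (fun _ _ _ => rfl) ⟨List.finRange n, 𝟙 _⟩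
    have h' : Wreath.Hom.diagram (f ≫ g) =
        ⟨f.diagram.1.push g.map, (List.length_map _).trans f.diagram.2⟩ := by
      apply Subtype.ext
      refine Eq.trans ?_ (h.symm.trans ?_)
      · exact congrArg (Diagram.mk _) (Category.id_comp _).symm
      · refine congrArg (fun D => Diagram.push g.map D) ?_
        exact congrArg (Diagram.mk _) (Category.id_comp _)
    rw [h', e, map_mul, Equiv.Perm.mul_apply, braidAction_push, braidAction_diagram f]
    have h₂ := braidAction_pre (n := n) (braidedTensorMap f) g.elt g.diagram
    rw [braidAction_diagram g] at h₂
    exact h₂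

end Braided

end Tensor

section Oplax

open Functor.OplaxMonoidal

variable {V : Type u₁} [Category.{v₁} V] [MonoidalCategory V]
  {W : Type u₂} [Category.{v₂} W] [MonoidalCategory W]

/-- The iterated comparison `F (X₁ ⊗ (⋯ ⊗ (Xₙ ⊗ 𝟙_ V))) ⟶ F X₁ ⊗ (⋯ ⊗ (F Xₙ ⊗ 𝟙_ W))` of an oplax
(that is, colax) monoidal functor. -/
def oplaxList (F : V ⥤ W) [F.OplaxMonoidal] {ι : Type w} (X : ι → V) :
    ∀ l : List ι, F.obj (tensorList X l) ⟶ tensorList (fun i => F.obj (X i)) l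
  | [] => η F
  | a :: l => δ F (X a) (tensorList X l) ≫ F.obj (X a) ◁ oplaxList F X l

variable (F : V ⥤ W) [F.OplaxMonoidal] {ι : Type w} {X Y : ι → V}

lemma oplax_tensorHom {A A' L L' : V} {M M' : W} (f : A ⟶ A') (g : L ⟶ L') (d : F.obj L ⟶ M)
    (d' : F.obj L' ⟶ M') (g' : M ⟶ M') (h : F.map g ≫ d' = d ≫ g') :
    F.map (f ⊗ₘ g) ≫ δ F A' L' ≫ F.obj A' ◁ d' = (δ F A L ≫ F.obj A ◁ d) ≫ (F.map f ⊗ₘ g') := by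
  rw [← δ_natural_assoc, ← id_tensorHom, tensorHom_comp_tensorHom, h, Category.assoc,
    ← id_tensorHom, tensorHom_comp_tensorHom]
  simp

lemma oplaxList_tensorListHom (f : ∀ i, X i ⟶ Y i) (l : List ι) :
    F.map (tensorListHom f l) ≫ oplaxList F Y l =
      oplaxList F X l ≫ tensorListHom (fun i => F.map (f i)) l := by
  induction l with
  | nil =>
    have : F.map (𝟙 (𝟙_ V)) ≫ η F = η F ≫ 𝟙 _ := by simp
    exact this
  | cons a l ih => exact oplax_tensorHom F _ _ _ _ _ ih

lemma oplaxList_tensorListPush {π : Equiv.Perm ι} (f : FamilyOver π X Y) (l : List ι) :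
    F.map (tensorListPush f l) ≫ oplaxList F Y (l.map π) =
      oplaxList F X l ≫ tensorListPush (X := fun i => F.obj (X i)) (Y := fun i => F.obj (Y i))
        (fun i j h => F.map (f i j h)) l := by
  induction l with
  | nil =>
    have : F.map (𝟙 (𝟙_ V)) ≫ η F = η F ≫ 𝟙 _ := by simp
    exact this
  | cons a l ih => exact oplax_tensorHom F _ _ _ _ _ ih

lemma oplax_crossing (c : ∀ A B : V, A ⊗ B ≅ B ⊗ A) (c' : ∀ A B : W, A ⊗ B ≅ B ⊗ A)
    (h : ∀ A B, F.map (c A B).hom ≫ δ F B A = δ F A B ≫ (c' (F.obj A) (F.obj B)).hom)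
    (hc : ∀ {A A' B B' : W} (f : A ⟶ A') (g : B ⟶ B'),
      (f ⊗ₘ g) ≫ (c' A' B').hom = (c' A B).hom ≫ (g ⊗ₘ f))
    (A B L : V) {M : W} (d : F.obj L ⟶ M) :
    F.map (crossing c A B L).hom ≫ δ F B (A ⊗ L) ≫ F.obj B ◁ (δ F A L ≫ F.obj A ◁ d) =
      (δ F A (B ⊗ L) ≫ F.obj A ◁ (δ F B L ≫ F.obj B ◁ d)) ≫
        (crossing c' (F.obj A) (F.obj B) M).hom := by
  have h₁ := crossing_natural c' hc (𝟙 (F.obj A)) (𝟙 (F.obj B)) d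
  simp only [id_tensorHom] at h₁
  simp only [whiskerLeft_comp, Category.assoc]
  rw [h₁]
  simp only [← Category.assoc]
  congr 1
  have a₁ := oplax_associativity F A B L
  have a₂ := oplax_associativity F B A L
  simp only [crossing, Iso.trans_hom, Iso.symm_hom, whiskerRightIso_hom, F.map_comp,
    Category.assoc]
  rw [← a₂, ← δ_natural_left_assoc, ← comp_whiskerRight_assoc, h]
  simp only [comp_whiskerRight, Category.assoc]
  have a₁' : δ F A (B ⊗ L) ≫ F.obj A ◁ δ F B L ≫ (α_ (F.obj A) (F.obj B) (F.obj L)).inv =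
      F.map (α_ A B L).inv ≫ δ F (A ⊗ B) L ≫ δ F A B ▷ F.obj L := by
    rw [← cancel_epi (F.map (α_ A B L).hom), ← reassoc_of% a₁]
    simp [← F.map_comp_assoc]
  rw [reassoc_of% a₁']

/-- A colax monoidal functor between braided monoidal categories is braided when its comparison maps
commute with the braidings. Between symmetric monoidal categories this is the notion of a symmetric
colax monoidal functor. -/
class OplaxBraided [BraidedCategory V] [BraidedCategory W] (F : V ⥤ W) [F.OplaxMonoidal] :
    Prop where
  braided : ∀ A B : V, F.map (β_ A B).hom ≫ δ F B A = δ F A B ≫ (β_ (F.obj A) (F.obj B)).hom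

lemma oplax_negBraiding [BraidedCategory V] [BraidedCategory W] [OplaxBraided F] (A B : V) :
    F.map (negBraiding V A B).hom ≫ δ F B A =
      δ F A B ≫ (negBraiding W (F.obj A) (F.obj B)).hom := by
  have := OplaxBraided.braided (F := F) B A
  simp only [Iso.symm_hom]
  rw [← cancel_epi (F.map (β_ B A).hom), ← F.map_comp_assoc, reassoc_of% this]
  simp

lemma IsPermutation.oplax [SymmetricCategory V] [SymmetricCategory W] [OplaxBraided F]
    {l l' : List ι} {m : tensorList X l ⟶ tensorList X l'} (h : IsPermutation X m) :
    ∃ m' : tensorList (fun i => F.obj (X i)) l ⟶ tensorList (fun i => F.obj (X i)) l',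
      IsPermutation (fun i => F.obj (X i)) m' ∧
        F.map m ≫ oplaxList F X l' = oplaxList F X l ≫ m' := by
  induction h with
  | nil =>
    have : F.map (𝟙 (𝟙_ V)) ≫ η F = η F ≫ 𝟙 _ := by simp
    exact ⟨_, .nil, this⟩
  | cons a _ ih =>
    obtain ⟨m', hm', e⟩ := ih
    refine ⟨_, hm'.cons a, ?_⟩
    have := oplax_tensorHom F (𝟙 (X a)) _ _ _ _ e
    rw [F.map_id, id_tensorHom, id_tensorHom] at this
    exact this
  | swap a b l =>
    exact ⟨_, .swap a b l, oplax_crossing F _ _ OplaxBraided.braided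
      (fun f g => BraidedCategory.braiding_naturality f g) _ _ _ _⟩
  | comp _ _ ih ih' =>
    obtain ⟨m, hm, e⟩ := ih
    obtain ⟨m', hm', e'⟩ := ih'
    exact ⟨_, hm.comp hm', by rw [F.map_comp, Category.assoc, e', reassoc_of% e]⟩

namespace Diagram

/-- The image of a diagram under a colax monoidal functor. -/
def oplax {T : V} (D : Diagram X T) : Diagram (fun i => F.obj (X i)) (F.obj T) :=
  ⟨D.word, F.map D.hom ≫ oplaxList F X D.word⟩

lemma oplax_pre {S T : V} (s : S ⟶ T) (D : Diagram X T) :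
    oplax F (D.pre s) = (oplax F D).pre (F.map s) :=
  congrArg (Diagram.mk _) (by simp [pre, oplax])

lemma oplax_cons {T : V} (a : ι) (D : Diagram X T) :
    oplax F (D.cons a) = pre (δ F (X a) T) (cons a (oplax F D)) := by
  have h : ∀ {A T L : V} {M : W} (u : T ⟶ L) (d : F.obj L ⟶ M),
      F.map (A ◁ u) ≫ δ F A L ≫ F.obj A ◁ d = δ F A T ≫ F.obj A ◁ (F.map u ≫ d) := by
    intros
    simp
  exact congrArg (Diagram.mk _) (h _ _)

lemma oplax_step (c : ∀ A B : V, A ⊗ B ≅ B ⊗ A) (c' : ∀ A B : W, A ⊗ B ≅ B ⊗ A)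
    (h : ∀ A B, F.map (c A B).hom ≫ δ F B A = δ F A B ≫ (c' (F.obj A) (F.obj B)).hom)
    (hc : ∀ {A A' B B' : W} (f : A ⟶ A') (g : B ⟶ B'),
      (f ⊗ₘ g) ≫ (c' A' B').hom = (c' A B).hom ≫ (g ⊗ₘ f))
    (i : ℕ) {T : V} (D : Diagram X T) :
    oplax F (step c i D) = step c' i (oplax F D) := by
  obtain ⟨l, u⟩ := D
  have triv : ∀ {T L : V} {M : W} (u : T ⟶ L) (d : F.obj L ⟶ M),
      F.map (u ≫ 𝟙 _) ≫ d = (F.map u ≫ d) ≫ 𝟙 _ := by simp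
  induction i generalizing T l with
  | zero =>
    match l, u with
    | [], u => exact congrArg (Diagram.mk _) (triv _ _)
    | [a], u => exact congrArg (Diagram.mk _) (triv _ _)
    | a :: b :: l, u =>
      have h' : ∀ {A B L : V} (u : T ⟶ A ⊗ (B ⊗ L)) {M : W} (d : F.obj L ⟶ M),
          F.map (u ≫ (crossing c A B L).hom) ≫
            δ F B (A ⊗ L) ≫ F.obj B ◁ (δ F A L ≫ F.obj A ◁ d) =
          (F.map u ≫ δ F A (B ⊗ L) ≫ F.obj A ◁ (δ F B L ≫ F.obj B ◁ d)) ≫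
            (crossing c' (F.obj A) (F.obj B) M).hom := by
        intro A B L u M d
        rw [F.map_comp, Category.assoc, oplax_crossing F c c' h hc]
        simp only [Category.assoc]
      exact congrArg (Diagram.mk _) (h' u _)
  | succ i ih =>
    match l, u with
    | [], u => exact congrArg (Diagram.mk _) (triv _ _)
    | a :: l, u =>
      obtain ⟨s, hs⟩ := exists_pre_cons a l u
      rw [hs]
      simp only [step_pre, step_cons, oplax_pre, oplax_cons, ih]

end Diagram

lemma braidAction_oplax [BraidedCategory V] [BraidedCategory W] [OplaxBraided F] {n : ℕ} {T : V}
    (b : BraidGroup n) : ∀ D : {D : Diagram X T // D.word.length = n},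
      braidAction n _ _ b ⟨D.1.oplax F, D.2⟩ =
        ⟨(braidAction n _ _ b D).1.oplax F, (braidAction n _ _ b D).2⟩ := by
  induction b using braid_induction with
  | one => intro D; simp
  | of i =>
    intro D
    rw [braidAction_of, braidAction_of]
    exact Subtype.ext
      (Diagram.oplax_step F _ _ OplaxBraided.braided posBraiding_natural _ _).symm
  | inv_of i =>
    intro D
    rw [map_inv, map_inv, braidAction_of, braidAction_of]
    exact Subtype.ext
      (Diagram.oplax_step F _ _ (oplax_negBraiding F) negBraiding_natural _ _).symm
  | mul a b ha hb =>
    intro D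
    rw [map_mul, map_mul, Equiv.Perm.mul_apply, Equiv.Perm.mul_apply, hb, ha]

lemma symmetric_naturality [SymmetricCategory V] [SymmetricCategory W] [OplaxBraided F]
    {n : ℕ} {X Y : Fin n → V} (π : Equiv.Perm (Fin n)) (f : FamilyOver π X Y)
    (p : ((List.finRange n).map π).Perm (List.finRange n)) :
    F.map (tensorListPush f (List.finRange n) ≫ permute Y p) ≫ oplaxList F Y (List.finRange n) =
      oplaxList F X (List.finRange n) ≫ tensorListPush (X := fun i => F.obj (X i))
        (Y := fun i => F.obj (Y i)) (fun i j h => F.map (f i j h)) (List.finRange n) ≫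
        permute (fun i => F.obj (Y i)) p := by
  obtain ⟨m, hm, e⟩ := (permute_spec Y p).oplax F
  rw [F.map_comp, Category.assoc, e, reassoc_of% oplaxList_tensorListPush F f]
  congr 2
  exact hm.eq_of_nodup (permute_spec _ _) (List.nodup_finRange n)

lemma braided_naturality [BraidedCategory V] [BraidedCategory W] [OplaxBraided F]
    {n : ℕ} {X Y : Wreath (braidPerm n) V} (f : Wreath.Hom X Y)
    (f' : Wreath.Hom (⟨fun i => F.obj (X.obj i)⟩ : Wreath (braidPerm n) W)
      ⟨fun i => F.obj (Y.obj i)⟩) (hf : f' = ⟨f.elt, fun i j h => F.map (f.map i j h)⟩) :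
    F.map (braidedTensorMap f) ≫ oplaxList F Y.obj (List.finRange n) =
      oplaxList F X.obj (List.finRange n) ≫ braidedTensorMap f' := by
  have h := braidAction_oplax F f.elt f.diagram
  have h₀ : (⟨f.diagram.1.oplax F, f.diagram.2⟩ : {D : Diagram (fun i => F.obj (Y.obj i))
      (F.obj (tensorList X.obj (List.finRange n))) // D.word.length = n}) =
      ⟨(Wreath.Hom.diagram f').1.pre (oplaxList F X.obj _), (Wreath.Hom.diagram f').2⟩ := by
    subst hf
    exact Subtype.ext (congrArg (Diagram.mk _) (oplaxList_tensorListPush F f.map _))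
  have e : f.elt = f'.elt := by rw [hf]
  rw [h₀, braidAction_pre, braidAction_diagram f, e, braidAction_diagram f'] at h
  have h' := congrArg Subtype.val h
  injection h' with _ h'
  exact h'.symm

end Oplax

section Squares

variable {V : Type u₁} [Category.{v₁} V] [MonoidalCategory V]
  {W : Type u₂} [Category.{v₂} W] [MonoidalCategory W]

/-- The action (tensor product functor) of the pseudo algebra that a monoidal category is. -/
def FreeMonoidal.action (V : Type u) [Category.{v} V] [MonoidalCategory V] :
    FreeMonoidal V ⥤ V :=
  Sigma.desc (tensorPi V)

/-- The action (tensor product functor) of the pseudo algebra that a symmetric monoidal category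
is. -/
noncomputable def FreeSymmetric.action (V : Type u) [Category.{v} V] [MonoidalCategory V]
    [SymmetricCategory V] : FreeSymmetric V ⥤ V :=
  Sigma.desc (tensorSymmetric V)

/-- The action (tensor product functor) of the pseudo algebra that a braided monoidal category
is. -/
def FreeBraided.action (V : Type u) [Category.{v} V] [MonoidalCategory V]
    [BraidedCategory V] : FreeBraided V ⥤ V :=
  Sigma.desc (tensorBraided V)

/-- The square of the colax morphism of pseudo algebras, for the 2-monad for monoidal categories, given
by a colax monoidal functor `F`: the 2-cell `F ∘ ⨂ ⟶ ⨂ ∘ FreeMonoidal.map F` whose components are the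
iterated comparison maps. The colax morphism is exact when this square is exact in the sense of
Guitart. -/
def monoidalSquare (F : V ⥤ W) [F.OplaxMonoidal] :
    TwoSquare (FreeMonoidal.action V) (FreeMonoidal.map F) F (FreeMonoidal.action W) :=
  Sigma.natTrans fun n =>
    { app := fun X => oplaxList F X (List.finRange n)
      naturality := fun _ _ f => oplaxList_tensorListHom F f _ }

/-- The square of the colax morphism of pseudo algebras, for the 2-monad for symmetric monoidal
categories, given by a symmetric colax monoidal functor `F`. -/
noncomputable def symmetricSquare [SymmetricCategory V] [SymmetricCategory W] (F : V ⥤ W) [F.OplaxMonoidal]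
    [OplaxBraided F] :
    TwoSquare (FreeSymmetric.action V) (FreeSymmetric.map F) F (FreeSymmetric.action W) :=
  Sigma.natTrans fun n =>
    { app := fun X => oplaxList F X.obj (List.finRange n)
      naturality := fun _ _ f => symmetric_naturality F f.elt f.map _ }

/-- The square of the colax morphism of pseudo algebras, for the 2-monad for braided monoidal
categories, given by a braided colax monoidal functor `F`. -/
def braidedSquare [BraidedCategory V] [BraidedCategory W] (F : V ⥤ W) [F.OplaxMonoidal]
    [OplaxBraided F] :
    TwoSquare (FreeBraided.action V) (FreeBraided.map F) F (FreeBraided.action W) :=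
  Sigma.natTrans fun n =>
    { app := fun X => oplaxList F X.obj (List.finRange n)
      naturality := fun _ _ f => braided_naturality F f _ rfl }

end Squares

end ExactColax

/-!
The categories `M V`, `S V` and `B V` have the same objects, and every morphism of `S V` or `B V`
factors uniquely as a permutation (resp. a braiding) of the entries followed by a morphism of
`M V`. A factorization of `γ` through the inclusions `M V ⟶ S V`, `M W ⟶ S W` therefore has to
begin by permuting the entries exactly as `γ` does, and the factorization which does nothing else
maps to every other one. So the square formed by these inclusions is exact; as they are surjective
on objects, pasting this square with the square of the symmetric (resp. braided) action neither
creates nor destroys exactness, and the result of the pasting is the square of the monoidal action.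
-/

namespace ExactColax

section Coproduct

open TwoSquare

universe v₃ v₄ u₃ u₄

/-- The coproduct of a family of functors. The categories involved may live in different universes,
unlike in `Sigma.Functor.sigma`. -/
def sigmaFunctor {I : Type w} {C : I → Type u₁} {D : I → Type u₂} [∀ i, Category.{v₁} (C i)]
    [∀ i, Category.{v₂} (D i)] (F : ∀ i, C i ⥤ D i) : (Σ i, C i) ⥤ Σ i, D i :=
  Sigma.desc fun i => F i ⋙ Sigma.incl i

variable {I : Type w} {C₁ : I → Type u₁} {C₂ : I → Type u₂} {C₃ : I → Type u₃} {C₄ : I → Type u₄}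
  [∀ i, Category.{v₁} (C₁ i)] [∀ i, Category.{v₂} (C₂ i)]
  [∀ i, Category.{v₃} (C₃ i)] [∀ i, Category.{v₄} (C₄ i)]
  {T : ∀ i, C₁ i ⥤ C₂ i} {L : ∀ i, C₁ i ⥤ C₃ i} {R : ∀ i, C₂ i ⥤ C₄ i} {B : ∀ i, C₃ i ⥤ C₄ i}

instance essSurj_sigmaFunctor [∀ i, (T i).EssSurj] : (sigmaFunctor T).EssSurj where
  mem_essImage := fun ⟨i, X⟩ =>
    ⟨⟨i, (T i).objPreimage X⟩, ⟨(Sigma.incl i).mapIso ((T i).objObjPreimageIso X)⟩⟩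

/-- Functors out of the summands which agree along `T` agree on the coproducts. -/
def sigmaFunctorCompDescIso {D : Type u} [Category.{v} D] {G : ∀ i, C₂ i ⥤ D}
    {H : ∀ i, C₁ i ⥤ D} (e : ∀ i, T i ⋙ G i ≅ H i) :
    sigmaFunctor T ⋙ Sigma.desc G ≅ Sigma.desc H :=
  Sigma.descUniq H _ fun i => e i

/-- The coproduct of a family of squares of functors. -/
def sigmaSquare (w : ∀ i, TwoSquare (T i) (L i) (R i) (B i)) :
    TwoSquare (sigmaFunctor T) (sigmaFunctor L) (sigmaFunctor R) (sigmaFunctor B) :=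
  Sigma.natTrans fun i =>
    { app := fun X => .mk ((w i).app X)
      naturality := fun _ _ f => congrArg Sigma.SigmaHom.mk ((w i).naturality f) }

variable (w : ∀ i, TwoSquare (T i) (L i) (R i) (B i))

/-- The factorizations of a morphism in the `i`-th square, viewed in the coproduct. -/
def sigmaFactorization {i : I} {X₂ : C₂ i} {X₃ : C₃ i} (g : (R i).obj X₂ ⟶ (B i).obj X₃) :
    (w i).StructuredArrowRightwards g ⥤
      (sigmaSquare w).StructuredArrowRightwards (X₂ := ⟨i, X₂⟩) (X₃ := ⟨i, X₃⟩) (.mk g) where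
  obj A := .mk _ _ ⟨i, A.right.left⟩ (.mk A.hom.left) (.mk A.right.hom)
    (congrArg Sigma.SigmaHom.mk (CostructuredArrow.w A.hom))
  map f := StructuredArrow.homMk
    (CostructuredArrow.homMk (.mk f.right.left)
      (congrArg Sigma.SigmaHom.mk (CostructuredArrow.w f.right)))
    (by
      ext
      exact congrArg Sigma.SigmaHom.mk (congrArg CommaMorphism.left (StructuredArrow.w f)))

lemma sigmaFactorization_obj_surjective {i : I} {X₂ : C₂ i} {X₃ : C₃ i}
    (g : (R i).obj X₂ ⟶ (B i).obj X₃) :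
    Function.Surjective (sigmaFactorization w g).obj := by
  intro A
  obtain ⟨⟨j, X₁⟩, a, b, comm, rfl⟩ := StructuredArrowRightwards.mk_surjective A
  change Sigma.SigmaHom ⟨i, _⟩ ⟨j, _⟩ at a
  obtain ⟨a⟩ := a
  change Sigma.SigmaHom ⟨i, _⟩ ⟨i, _⟩ at b
  obtain ⟨b⟩ := b
  exact ⟨.mk _ _ X₁ a b (by injection comm), rfl⟩

instance guitartExact_sigmaSquare [∀ i, (w i).GuitartExact] : (sigmaSquare w).GuitartExact := by
  rw [guitartExact_iff_isConnected_rightwards]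
  rintro ⟨i, X₂⟩ ⟨j, X₃⟩ (g : Sigma.SigmaHom ⟨i, _⟩ ⟨j, _⟩)
  obtain ⟨g⟩ := g
  have hg := (guitartExact_iff_isConnected_rightwards (w i)).1 inferInstance g
  have := hg.is_nonempty.map (sigmaFactorization w g).obj
  refine zigzag_isConnected fun A A' => ?_
  obtain ⟨A, rfl⟩ := sigmaFactorization_obj_surjective w g A
  obtain ⟨A', rfl⟩ := sigmaFactorization_obj_surjective w g A'
  exact zigzag_obj_of_zigzag _ (isPreconnected_zigzag A A')

end Coproduct

section Pasting

universe v₃ v₄ v₅ v₆ u₃ u₄ u₅ u₆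

variable {C₁ : Type u₁} {C₂ : Type u₂} {C₃ : Type u₃} {D₁ : Type u₄} {D₂ : Type u₅} {D₃ : Type u₆}
  [Category.{v₁} C₁] [Category.{v₂} C₂] [Category.{v₃} C₃]
  [Category.{v₄} D₁] [Category.{v₅} D₂] [Category.{v₆} D₃]
  {T : C₁ ⥤ C₂} {B : D₁ ⥤ D₂} {T' : C₂ ⥤ C₃} {B' : D₂ ⥤ D₃} {T'' : C₁ ⥤ C₃} {B'' : D₁ ⥤ D₃}
  {L : C₁ ⥤ D₁} {M : C₂ ⥤ D₂} {R : C₃ ⥤ D₃}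

lemma map_id_comp_eq_comp_map_id (F : C₁ ⥤ C₃) (G : C₂ ⥤ C₃) {X : C₁} {Y : C₂}
    (f : F.obj X ⟶ G.obj Y) : F.map (𝟙 X) ≫ f = f ≫ G.map (𝟙 Y) ≫ 𝟙 (G.obj Y) := by
  simp

lemma guitartExact_iff_of_hComp (w : TwoSquare T L M B) [w.GuitartExact] [B.EssSurj]
    (w' : TwoSquare T' M R B') (w'' : TwoSquare T'' L R B'')
    (eT : T ⋙ T' ≅ T'') (eB : B ⋙ B' ≅ B'')
    (h : ∀ X, R.map (eT.hom.app X) ≫ w''.app X =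
      w'.app (T.obj X) ≫ B'.map (w.app X) ≫ eB.hom.app (L.obj X)) :
    w'.GuitartExact ↔ w''.GuitartExact := by
  obtain rfl : w.hComp' w' eT eB = w'' := by
    ext X
    have := h X
    rw [← Iso.app_hom, ← Functor.mapIso_hom, ← Iso.eq_inv_comp] at this
    simp [this]
  exact (TwoSquare.GuitartExact.hComp'_iff_of_essSurj w w' eT eB).symm

end Pasting

namespace Wreath

variable {n : ℕ} {G : Type} [Group G] (ρ : G →* Equiv.Perm (Fin n))
  (V : Type u) [Category.{v} V]

/-- The inclusion of the sequences of morphisms into the wreath product, over the unit of the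
group. -/
def ofPi : (Fin n → V) ⥤ Wreath ρ V where
  obj X := ⟨X⟩
  map {X Y} f := ⟨1, fun i _ h => f i ≫ eqToHom (congrArg Y (by rw [← h, map_one]; rfl))⟩
  map_id X := Hom.ext' rfl fun _ _ _ _ => Category.id_comp _
  map_comp {X Y Z} f g := by
    refine Hom.ext' (one_mul 1).symm fun i j h _ => ?_
    obtain rfl : i = j := by rw [← h, map_one]; rfl
    have comp_transport : ∀ k (hk : i = k), f i ≫ g i =
        (f i ≫ eqToHom (congrArg Y hk)) ≫ g k ≫ eqToHom (congrArg Z hk.symm) := by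
      rintro k rfl
      simp
    exact (Category.comp_id _).trans (comp_transport _ (by rw [map_one]; rfl))

instance essSurj_ofPi : (ofPi ρ V).EssSurj where
  mem_essImage X := ⟨X.obj, ⟨Iso.refl X⟩⟩

variable {ρ V}

lemma comp_ofPi_map {X : Wreath ρ V} {Y Z : Fin n → V} (a : X ⟶ (ofPi ρ V).obj Y) (f : Y ⟶ Z) :
    a ≫ (ofPi ρ V).map f = (⟨a.elt, fun i j h => a.map i j h ≫ f j⟩ : Hom X _) := by
  refine Hom.ext' (one_mul _) fun i j _ h => ?_
  subst h
  exact congrArg (a.map i _ rfl ≫ ·) (Category.comp_id _)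

lemma elt_comp_ofPi_map {X : Wreath ρ V} {Y Z : Fin n → V} (a : X ⟶ (ofPi ρ V).obj Y)
    (f : Y ⟶ Z) : Hom.elt (a ≫ (ofPi ρ V).map f) = a.elt :=
  one_mul _

/-- The sequence obtained by permuting the entries of `X` according to `g`. -/
def permuted (X : Wreath ρ V) (g : G) : Fin n → V := fun j => X.obj ((ρ g).symm j)

/-- The morphism over `g` all of whose components are identities. -/
def toPermuted (X : Wreath ρ V) (g : G) : X ⟶ (ofPi ρ V).obj (X.permuted g) :=
  Hom.mk g fun i _ h => eqToHom (congrArg X.obj (by rw [← h, Equiv.symm_apply_apply]))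

lemma existsUnique_toPermuted_comp {X : Wreath ρ V} {Z : Fin n → V} (a : X ⟶ (ofPi ρ V).obj Z)
    {g : G} (hg : a.elt = g) :
    ∃! f : X.permuted g ⟶ Z, X.toPermuted g ≫ (ofPi ρ V).map f = a := by
  refine ⟨fun j => a.map _ j (by rw [hg, Equiv.apply_symm_apply]), ?_,
    fun f hf => funext fun j => ?_⟩
  · subst hg
    refine (comp_ofPi_map _ _).trans (Hom.ext' rfl fun i j _ hj => ?_)
    have transport_comp : ∀ k (hk : i = k) (h' : ρ a.elt k = j),
        eqToHom (congrArg X.obj hk) ≫ a.map k j h' = a.map i j hj := by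
      rintro k rfl h'
      simp
    exact transport_comp _ (by rw [← hj]; exact (Equiv.symm_apply_apply _ _).symm) _
  · obtain rfl := (comp_ofPi_map (X.toPermuted g) f).symm.trans hf
    exact (Category.id_comp _).symm

variable {W : Type u₂} [Category.{v₂} W]

section

variable (F : V ⥤ W)

lemma mapFunctor_map_toPermuted (X : Wreath ρ V) (g : G) :
    (mapFunctor ρ F).map (X.toPermuted g) = ((mapFunctor ρ F).obj X).toPermuted g :=
  Hom.ext' rfl fun i _ h _ => eqToHom_map F
    (congrArg X.obj (show i = (ρ g).symm _ by rw [← h]; exact (Equiv.symm_apply_apply _ _).symm))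

lemma mapFunctor_map_ofPi_map {X Y : Fin n → V} (f : X ⟶ Y) :
    (mapFunctor ρ F).map ((ofPi ρ V).map f) = (ofPi ρ W).map ((piMap n F).map f) :=
  Hom.ext' rfl fun i _ _ _ =>
    (F.map_comp _ _).trans (congrArg (F.map (f i) ≫ ·) (eqToHom_map F _))

variable (ρ)

/-- The naturality square of `ofPi` with respect to a functor `F`, which commutes strictly. -/
def ofPiSquare : TwoSquare (ofPi ρ V) (piMap n F) (mapFunctor ρ F) (ofPi ρ W) where
  app X := 𝟙 ((ofPi ρ W).obj ((piMap n F).obj X))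
  naturality _ _ f :=
    (Category.comp_id _).trans ((mapFunctor_map_ofPi_map F f).trans (Category.id_comp _).symm)

variable {ρ F}

lemma map_comp_ofPiSquare_comp {X : Wreath ρ V} {Y : Fin n → W} {Z : Fin n → V}
    (a : X ⟶ (ofPi ρ V).obj Z) (b : (piMap n F).obj Z ⟶ Y) :
    (mapFunctor ρ F).map a ≫ (ofPiSquare ρ F).app Z ≫ (ofPi ρ W).map b =
      (mapFunctor ρ F).map a ≫ (ofPi ρ W).map b :=
  congrArg ((mapFunctor ρ F).map a ≫ ·) (Category.id_comp _)

lemma exists_hom_of_toPermuted_comp_eq {X : Wreath ρ V} {Y : Fin n → W} {Z : Fin n → V} {g : G}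
    {b₀ : (piMap n F).obj (X.permuted g) ⟶ Y} {a : X ⟶ (ofPi ρ V).obj Z}
    {b : (piMap n F).obj Z ⟶ Y}
    (h : (mapFunctor ρ F).map (X.toPermuted g) ≫ (ofPi ρ W).map b₀ =
      (mapFunctor ρ F).map a ≫ (ofPi ρ W).map b) :
    ∃ f : X.permuted g ⟶ Z,
      X.toPermuted g ≫ (ofPi ρ V).map f = a ∧ (piMap n F).map f ≫ b = b₀ := by
  have ha : a.elt = g :=
    (elt_comp_ofPi_map ((mapFunctor ρ F).map a) b).symm.trans
      ((congrArg Hom.elt h).symm.trans (elt_comp_ofPi_map _ b₀))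
  obtain ⟨f, rfl, -⟩ := existsUnique_toPermuted_comp a ha
  rw [mapFunctor_map_toPermuted] at h
  refine ⟨f, rfl, (existsUnique_toPermuted_comp (X := (mapFunctor ρ F).obj X)
    (toPermuted _ g ≫ (ofPi ρ W).map b₀) (elt_comp_ofPi_map _ b₀)).unique ?_ rfl⟩
  refine (congrArg (_ ≫ ·) ((ofPi ρ W).map_comp ((piMap n F).map f) b)).trans (Eq.trans ?_ h.symm)
  rw [Functor.map_comp, mapFunctor_map_toPermuted, mapFunctor_map_ofPi_map]
  exact (Category.assoc _ _ _).symm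

instance guitartExact_ofPiSquare : (ofPiSquare ρ F).GuitartExact := by
  rw [TwoSquare.guitartExact_iff_isConnected_rightwards]
  intro X Y γ
  obtain ⟨b₀, hb₀, -⟩ := existsUnique_toPermuted_comp γ rfl
  rw [← mapFunctor_map_toPermuted] at hb₀
  let S : (ofPiSquare ρ F).StructuredArrowRightwards γ :=
    .mk _ _ (X.permuted γ.elt) (X.toPermuted γ.elt) b₀
      ((map_comp_ofPiSquare_comp _ _).trans hb₀)
  have exists_hom : ∀ A, Nonempty (S ⟶ A) := by
    intro A
    obtain ⟨Z, a, b, h, rfl⟩ := TwoSquare.StructuredArrowRightwards.mk_surjective A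
    rw [map_comp_ofPiSquare_comp] at h
    obtain ⟨f, hf, hfb⟩ := exists_hom_of_toPermuted_comp_eq (hb₀.trans h.symm)
    exact ⟨StructuredArrow.homMk (CostructuredArrow.homMk f hfb) (by ext; exact hf)⟩
  have : Nonempty ((ofPiSquare ρ F).StructuredArrowRightwards γ) := ⟨S⟩
  exact zigzag_isConnected fun A B => .of_inv_hom (exists_hom A).some (exists_hom B).some

end

end Wreath

section Inclusion

variable {G : ℕ → Type} [∀ n, Group (G n)] (ρ : ∀ n, G n →* Equiv.Perm (Fin n))

/-- The inclusion of `FreeMonoidal V` in the coproduct of the wreath products `Wreath (ρ n) V`;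
the free symmetric and the free braided monoidal category are of this form. -/
abbrev wreathInclusion (V : Type u) [Category.{v} V] : FreeMonoidal V ⥤ Σ n, Wreath (ρ n) V :=
  sigmaFunctor fun n => Wreath.ofPi (ρ n) V

variable {V : Type u₁} [Category.{v₁} V] {W : Type u₂} [Category.{v₂} W] (F : V ⥤ W)

/-- The naturality square of `wreathInclusion` with respect to a functor `F`. -/
def wreathInclusionSquare :
    TwoSquare (wreathInclusion ρ V) (FreeMonoidal.map F)
      (sigmaFunctor fun n => Wreath.mapFunctor (ρ n) F) (wreathInclusion ρ W) :=
  sigmaSquare fun n => Wreath.ofPiSquare (ρ n) F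

instance guitartExact_wreathInclusionSquare : (wreathInclusionSquare ρ F).GuitartExact :=
  guitartExact_sigmaSquare _

end Inclusion

section Tensor

variable {V : Type u} [Category.{v} V] [MonoidalCategory V]

lemma Diagram.mk_tensorListPush {ι : Type w} {X Y : ι → V} {σ : Equiv.Perm ι} (hσ : σ = 1)
    (f : FamilyOver σ X Y) (l : List ι) :
    (⟨l.map σ, tensorListPush f l⟩ : Diagram Y (tensorList X l)) =
      ⟨l, tensorListHom (fun i => f i i (by rw [hσ]; rfl)) l⟩ := by
  subst hσ
  induction l with
  | nil => rfl
  | cons a l ih =>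
    exact congrArg (fun D : Diagram Y _ => Diagram.mk (a :: D.word) (f a a rfl ⊗ₘ D.hom)) ih

variable {n : ℕ}

lemma Wreath.mk_tensorListPush_ofPi_map {G : Type} [Group G] (ρ : G →* Equiv.Perm (Fin n))
    {X Y : Fin n → V} (f : X ⟶ Y) (l : List (Fin n)) :
    (⟨l.map (ρ 1), tensorListPush ((ofPi ρ V).map f).map l⟩ : Diagram Y (tensorList X l)) =
      ⟨l, tensorListHom f l⟩ :=
  (Diagram.mk_tensorListPush (map_one ρ) _ l).trans
    (congrArg (fun f => Diagram.mk l (tensorListHom f l)) (funext fun _ => Category.comp_id _))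

lemma tensorSymmetric_map_ofPi_map [SymmetricCategory V] {X Y : Fin n → V} (f : X ⟶ Y) :
    (tensorSymmetric V n).map ((Wreath.ofPi _ V).map f) = (tensorPi V n).map f := by
  have comp_permute := Diagram.comp_permute_congr
    (Wreath.mk_tensorListPush_ofPi_map (MonoidHom.id (Equiv.Perm (Fin n))) f (List.finRange n))
    (Equiv.Perm.map_finRange_perm _) (List.Perm.refl _)
  have permute_refl : permute Y (List.Perm.refl (List.finRange n)) = 𝟙 _ :=
    (permute_spec _ _).eq_of_nodup (IsPermutation.id _ _) (List.nodup_finRange n)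
  exact comp_permute.trans ((congrArg (_ ≫ ·) permute_refl).trans (Category.comp_id _))

lemma tensorBraided_map_ofPi_map [BraidedCategory V] {X Y : Fin n → V} (f : X ⟶ Y) :
    (tensorBraided V n).map ((Wreath.ofPi _ V).map f) = (tensorPi V n).map f := by
  refine braidedTensorMap_eq _ ?_
  change braidAction n _ _ 1 _ = _
  rw [map_one]
  exact Subtype.ext (Wreath.mk_tensorListPush_ofPi_map (braidPerm n) f _)

variable (V)

/-- The symmetric action extends the monoidal one. -/
noncomputable def wreathInclusionCompSymmetric [SymmetricCategory V] :
    wreathInclusion _ V ⋙ FreeSymmetric.action V ≅ FreeMonoidal.action V :=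
  sigmaFunctorCompDescIso fun n =>
    NatIso.ofComponents (fun X => Iso.refl ((tensorPi V n).obj X)) fun f =>
      (Category.comp_id _).trans
        ((tensorSymmetric_map_ofPi_map f).trans (Category.id_comp _).symm)

/-- The braided action extends the monoidal one. -/
def wreathInclusionCompBraided [BraidedCategory V] :
    wreathInclusion _ V ⋙ FreeBraided.action V ≅ FreeMonoidal.action V :=
  sigmaFunctorCompDescIso fun n =>
    NatIso.ofComponents (fun X => Iso.refl ((tensorPi V n).obj X)) fun f =>
      (Category.comp_id _).trans
        ((tensorBraided_map_ofPi_map f).trans (Category.id_comp _).symm)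

end Tensor

section Comparison

variable {V : Type u₁} [Category.{v₁} V] [MonoidalCategory V]
  {W : Type u₂} [Category.{v₂} W] [MonoidalCategory W] (F : V ⥤ W) [F.OplaxMonoidal]

theorem guitartExact_symmetricSquare_iff [SymmetricCategory V] [SymmetricCategory W]
    [OplaxBraided F] : (symmetricSquare F).GuitartExact ↔ (monoidalSquare F).GuitartExact :=
  guitartExact_iff_of_hComp (wreathInclusionSquare _ F) (symmetricSquare F) (monoidalSquare F)
    (wreathInclusionCompSymmetric V) (wreathInclusionCompSymmetric W) fun ⟨n, X⟩ =>
      map_id_comp_eq_comp_map_id F (tensorSymmetric W n) (Y := ⟨fun i => F.obj (X i)⟩)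
        (oplaxList F X (List.finRange n))

theorem guitartExact_braidedSquare_iff [BraidedCategory V] [BraidedCategory W]
    [OplaxBraided F] : (braidedSquare F).GuitartExact ↔ (monoidalSquare F).GuitartExact :=
  guitartExact_iff_of_hComp (wreathInclusionSquare _ F) (braidedSquare F) (monoidalSquare F)
    (wreathInclusionCompBraided V) (wreathInclusionCompBraided W) fun ⟨n, X⟩ =>
      map_id_comp_eq_comp_map_id F (tensorBraided W n) (Y := ⟨fun i => F.obj (X i)⟩)
        (oplaxList F X (List.finRange n))

end Comparison

end ExactColax

theorem proposition4p17 :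
    (∀ {V : Type u₁} [Category.{v₁} V] [MonoidalCategory V] [SymmetricCategory V]
      {W : Type u₂} [Category.{v₂} W] [MonoidalCategory W] [SymmetricCategory W]
      (F : V ⥤ W) [F.OplaxMonoidal] [ExactColax.OplaxBraided F],
      (ExactColax.symmetricSquare F).GuitartExact ↔ (ExactColax.monoidalSquare F).GuitartExact) ∧
    (∀ {V : Type u₁} [Category.{v₁} V] [MonoidalCategory V] [BraidedCategory V]
      {W : Type u₂} [Category.{v₂} W] [MonoidalCategory W] [BraidedCategory W]
      (F : V ⥤ W) [F.OplaxMonoidal] [ExactColax.OplaxBraided F],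
      (ExactColax.braidedSquare F).GuitartExact ↔ (ExactColax.monoidalSquare F).GuitartExact) :=
  ⟨fun F _ _ => ExactColax.guitartExact_symmetricSquare_iff F,
    fun F _ _ => ExactColax.guitartExact_braidedSquare_iff F⟩
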